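/- **Setting.** Let $G=(V,E)$ be a finite simple graph with $N=|V|$ nodes and maximum degree $d(G)$; $\mathcal N(i)$ denotes the neighbours of node $i$. Let $k\ge 1$, and let $\mathcal T$ be a rooted tree with $k$ edges whose vertices $u_0,\dots,u_k$ are listed bottom-up (every vertex precedes its parent, so $u_k$ is the root). Write $\mathcal C(\ell)$ for the set of indices of the children of $u_\ell$ and $\mathcal L$ for the set of indices of leaves. The pattern count $Q_{\mathcal T}$ is the number of injective maps $f$ from the vertices of $\mathcal T$ to $V$ that send every edge of $\mathcal T$ to an edge of $G$ (occurrences that differ in the roles of the nodes are counted separately). **The mechanism $\mathcal M_{\mathcal T}$** with privacy budget $\varepsilon>0$ is the following multi-round local mechanism: in every round each node sends a message that depends only on its own neighbourhood, its own randomness and the messages of earlier rounds. Initially $\mathcal X^{(\ell)}_i=1$ for every leaf index $\ell\in\mathcal L$ and every node $i$. In a marking round, each node $i$ draws and publishes an independent uniform mark $r_i\in\{0,\dots,k\}$. Then there is one round for each $\ell\notin\mathcal L$, in increasing order of $\ell$, in which every node $i$ with $r_i=\ell$ computes, with fresh independent noise for each child, $$\mathcal X^{(\ell)}_i=\prod_{c\in\mathcal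 C(\ell)}\Big(\sum_{j\in\mathcal N(i)}\mathcal X^{(c)}_j\mathbf 1\{r_j=c\}+\mathrm{Lap}\big(\|\mathcal X^{(c)}\|_\infty/\varepsilon\big)\Big),$$ while the other nodes contribute $\mathcal X_i^{(\ell)}=0$; here $\|\mathcal X^{(c)}\|_\infty=\max_j|\mathcal X^{(c)}_j|$ and $\mathrm{Lap}(b)$ is the centred Laplace law of scale $b$ (the constant $0$ if $b=0$). The output is $$\mathcal M_{\mathcal T}(G,\varepsilon)=(k+1)^{k+1}\sum_{i\in V}\mathcal X^{(k)}_i\,\mathbf 1\{r_i=k\}.$$ **Theorem.** For every such $k$, $\mathcal T$, $G$ and every $\varepsilon>0$: 1. $\mathcal M_{\mathcal T}$ has exactly $k+2-|\mathcal L|$ rounds. 2. $\mathcal M_{\mathcal T}(G,\varepsilon)$ is integrable and $\mathbb E[\mathcal M_{\mathcal T}(G,\varepsilon)]=Q_{\mathcal T}$. 3. Let $\beta\in(0,1)$ and suppose that $\varepsilon\le\sqrt{8(k+1)/3}$ and, in the single-edge case $k=1$ only, that $\log(12kN/\beta)\le N$. Then with probability at least $1-\beta$ $$|\mathcal M_{\mathcal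 T}(G,\varepsilon)-Q_{\mathcal T}|\le (k+1)\sqrt{2N\beta^{-1}}\,(d(G)+k+1)^k+k(k+1)\,\gamma\sqrt N\,\big(\hat d+\gamma\sqrt{\hat d}+\gamma\big)^{k-1},$$ where $\gamma=(k+1)\sqrt{8\log(12kN/\beta)}/\varepsilon$ and $\hat d=\max(d(G),\lceil\gamma^2\rceil)$. 4. For fixed $k,\varepsilon,\beta$, one has $\gamma=\tilde O(1)$ and the right-hand side in (3) is $\tilde O(\sqrt N\,d(G)^k)$: there are a constant $C$ and an exponent $p$, depending only on $k,\varepsilon,\beta$, such that whenever $N\ge2$ and $d(G)\ge1$, $\gamma\le C(\log N)^p$ and the right-hand side is at most $C\sqrt N\,d(G)^k(\log N)^p$. -/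

import Mathlib

open MeasureTheory

noncomputable section

/-- A rooted tree with `k` edges on the vertices `u_0, …, u_k`, listed bottom-up: every vertex other
than the root `u_k` has exactly one parent, and it is listed before its parent. -/
structure PatternTree (k : ℕ) where
  parent : Fin k → Fin (k + 1)
  lt_parent : ∀ c : Fin k, c.castSucc < parent c

namespace PatternTree

variable {k : ℕ}

/-- The children of a vertex. The root is nobody's child, so children are indexed by `Fin k`. -/
def children (T : PatternTree k) (ℓ : Fin (k + 1)) : Finset (Fin k) :=
  Finset.univ.filter fun c => T.parent c = ℓ

/-- The set of leaves. -/
def leaves (T : PatternTree k) : Finset (Fin (k + 1)) :=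
  Finset.univ.filter fun ℓ => T.children ℓ = ∅

/-- The vertices that are not leaves. -/
def internals (T : PatternTree k) : Finset (Fin (k + 1)) :=
  Finset.univ.filter fun ℓ => T.children ℓ ≠ ∅

/-- The acyclic pattern: the underlying undirected graph of the tree. -/
def pattern (T : PatternTree k) : SimpleGraph (Fin (k + 1)) :=
  SimpleGraph.fromRel fun u v => ∃ c : Fin k, u = c.castSucc ∧ v = T.parent c

/-- The pattern count in `G`: the number of injective homomorphisms of the pattern into `G`
(occurrences whose nodes play different roles are different). -/
def patternCount {V : Type*} [Fintype V] (T : PatternTree k) (G : SimpleGraph V) : ℕ :=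
  G.labelledCopyCount T.pattern

end PatternTree

/-- A multi-round mechanism in the local model. Every node draws a private seed, independently of the
other nodes. The rounds in `schedule` are executed one after the other; in a round, each node sends a
message computed from its own identity, the set of its own neighbours, its own seed and the messages
of the earlier rounds. In the end the analyzer computes the output from all messages. The messages of
a round that has not been executed have the public default value `init`. -/
structure LocalMechanism (V Round : Type*) (Msg : Round → Type*) (Seed : Type*)
    [MeasurableSpace Seed] where
  schedule : List Round
  seedLaw : Measure Seed
  init : (r : Round) → V → Msg r
  randomizer : (r : Round) → V → Finset V → Seed → ((s : Round) → V → Msg s) → Msg r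
  analyzer : ((r : Round) → V → Msg r) → ℝ

namespace LocalMechanism

variable {V Round : Type*} {Msg : Round → Type*} {Seed : Type*} [MeasurableSpace Seed]

/-- The number of rounds. -/
def rounds (M : LocalMechanism V Round Msg Seed) : ℕ := M.schedule.length

/-- One round: all nodes simultaneously send their messages of round `r`. -/
def step [Fintype V] [DecidableEq Round] (M : LocalMechanism V Round Msg Seed)
    (G : SimpleGraph V) [DecidableRel G.Adj] (ω : V → Seed)
    (B : (r : Round) → V → Msg r) (r : Round) : (r : Round) → V → Msg r :=
  Function.update B r fun i => M.randomizer r i (G.neighborFinset i) (ω i) B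

/-- All messages of the execution on `G` with seeds `ω`. -/
def transcript [Fintype V] [DecidableEq Round] (M : LocalMechanism V Round Msg Seed)
    (G : SimpleGraph V) [DecidableRel G.Adj] (ω : V → Seed) : (r : Round) → V → Msg r :=
  M.schedule.foldl (M.step G ω) M.init

/-- The output on `G` with seeds `ω`. -/
def output [Fintype V] [DecidableEq Round] (M : LocalMechanism V Round Msg Seed)
    (G : SimpleGraph V) [DecidableRel G.Adj] (ω : V → Seed) : ℝ :=
  M.analyzer (M.transcript G ω)

/-- The joint law of the seeds of all nodes. -/
def law [Fintype V] (M : LocalMechanism V Round Msg Seed) : Measure (V → Seed) :=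
  Measure.pi fun _ => M.seedLaw

end LocalMechanism

/-- The standard Laplace distribution `Lap(1)`; if `Z` has this law, then `b * Z` has law `Lap(b)`. -/
def laplaceStd : Measure ℝ :=
  volume.withDensity fun x => ENNReal.ofReal (Real.exp (-|x|) / 2)

/-- The messages of the tree mechanism: marks in the marking round `none`, real counts in the round
`some ℓ` of the tree vertex `u_ℓ`. -/
@[reducible] def TreeMsg (k : ℕ) : Option (Fin (k + 1)) → Type
  | none => Fin (k + 1)
  | some _ => ℝ

/-- The mechanism `M_T` with privacy budget `ε`.
* The seed of a node consists of a uniform mark in `{0, …, k}` and, for each non-root tree vertex `c`,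
  an independent standard Laplace variable.
* There is one marking round, and then one round for each non-leaf tree vertex, bottom-up.
* Before the rounds, the counts of leaf vertices are set to `1` at every node (others to `0`).
* In the round of the vertex `u_ℓ`, each node with mark `ℓ` forms, for each child `c` of `u_ℓ`, the
  sum of the counts for `c` of its neighbours with mark `c`, adds Laplace noise whose scale is the
  largest absolute count for `c` divided by `ε`, and sends the product over all children; the other
  nodes contribute `0`.
* The analyzer adds the root counts of the nodes with mark `k` and rescales by `(k + 1) ^ (k + 1)`. -/
def treeMechanism {k : ℕ} (T : PatternTree k) (ε : ℝ) (V : Type*) [Fintype V] :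
    LocalMechanism V (Option (Fin (k + 1))) (TreeMsg k) (Fin (k + 1) × (Fin k → ℝ)) where
  schedule := none :: (T.internals.sort (· ≤ ·)).map some
  seedLaw := (PMF.uniformOfFintype (Fin (k + 1))).toMeasure.prod (Measure.pi fun _ => laplaceStd)
  init := fun r => match r with
    | none => fun _ => 0
    | some ℓ => fun _ => if ℓ ∈ T.leaves then 1 else 0
  randomizer := fun r i nbrs seed B => match r with
    | none => seed.1
    | some ℓ =>
      let mark : V → Fin (k + 1) := B none
      let count : Fin (k + 1) → V → ℝ := fun c => B (some c)
      if mark i = ℓ then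
        ∏ c ∈ T.children ℓ,
          ((∑ j ∈ nbrs, if mark j = c.castSucc then count c.castSucc j else 0)
            + ‖count c.castSucc‖ / ε * seed.2 c)
      else 0
  analyzer := fun B =>
    let mark : V → Fin (k + 1) := B none
    let count : V → ℝ := B (some (Fin.last k))
    ((k : ℝ) + 1) ^ (k + 1) * ∑ i, if mark i = Fin.last k then count i else 0

/-- `γ = (k + 1) √(8 log (12 k N / β)) / ε`. -/
def noiseFactor (k N : ℕ) (ε β : ℝ) : ℝ :=
  (k + 1) * √(8 * Real.log (12 * k * N / β)) / ε

/-- `d̂ = max (d, ⌈γ²⌉)`. -/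
def dHat (k N d : ℕ) (ε β : ℝ) : ℝ :=
  ((max d ⌈noiseFactor k N ε β ^ 2⌉₊ : ℕ) : ℝ)

/-- `(k+1) √(2N/β) (d+k+1)^k + k (k+1) γ √N (d̂ + γ √d̂ + γ)^(k-1)`. -/
def errorBound (k N d : ℕ) (ε β : ℝ) : ℝ :=
  (k + 1) * √(2 * N / β) * ((d : ℝ) + k + 1) ^ k
    + k * (k + 1) * noiseFactor k N ε β * √(N : ℝ)
      * (dHat k N d ε β + noiseFactor k N ε β * √(dHat k N d ε β) + noiseFactor k N ε β) ^ (k - 1)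

end

/-! The vertex `u_0` is always a leaf, so a tree can be consumed one leaf at a time: the counts for
`u_0` are summed over neighbours and multiplied into the weight of its parent. `homSum` does this
without noise and counts weighted tree homomorphisms; `noisySum` does it with noise, and
`output_eq_noisySum` identifies the output with `(k+1)^(k+1)` times the latter. The statements about
the noise are inductions along this recursion.

Unbiasedness: once the marks are fixed, the noise scale for `u_0` is a constant, and after averaging
over all later noise the result is affine in the centred noise of `u_0`. Hence the noise disappears
in the mean (`integral_noisySum`). With mark indicators as weights only injective homomorphisms
survive, because a node carries one mark, and each survives with probability `(k+1)^(-(k+1))`.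

The error splits into the fluctuation of the marks and that of the noise. For the marks, Chebyshev
suffices: pairs of occurrences that agree at no tree vertex contribute nothing positive to the
variance, and the others are counted by pinning a common vertex and extending along edges
(`homSum_le_prod`). For the noise, removing it edge by edge leaves `k` linear forms in independent
Laplace variables. As long as every noisy neighbourhood count is at most `B`, a message grows by at
most a factor `B` per edge, so the coefficients are at most `B^(k-1)/ε` (`noiseLaw_deviation_le`).

Put `L = log (12kN/β)`. If `L ≤ N`, Chernoff's bound permits `B = (d̂ + γ√d̂ + γ)/(k+1)`, the linear
forms are subgaussian at scale `√(8NL)`, and the second term of the error bound comes out exactly.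
If `N ≤ L`, the linear forms only have exponential tails at scale `3L`, and the crude `B = d + L/ε`
is used. For `k ≥ 2`, `noise_alternative` then shows that the noise is covered either by the second
term or by one sixth of the first, for which Chebyshev's inequality leaves room. -/

noncomputable section

/-! ### Removing the first leaf of a tree -/

namespace PatternTree

variable {k : ℕ}

lemma parent_ne_zero (T : PatternTree k) (c : Fin k) : T.parent c ≠ 0 :=
  Fin.ne_zero_of_lt (T.lt_parent c)

/-- The tree without its first vertex, which is a leaf. -/
def tail (T : PatternTree (k + 1)) : PatternTree k where
  parent c := (T.parent c.succ).pred (T.parent_ne_zero _)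
  lt_parent c := by
    have h := T.lt_parent c.succ
    rw [Fin.lt_def] at h ⊢
    simp at h ⊢
    omega

/-- The parent of the first vertex, as a vertex of `T.tail`. -/
def firstParent (T : PatternTree (k + 1)) : Fin (k + 1) :=
  (T.parent 0).pred (T.parent_ne_zero _)

lemma succ_tail_parent (T : PatternTree (k + 1)) (c : Fin k) :
    (T.tail.parent c).succ = T.parent c.succ := by simp [tail]

lemma succ_firstParent (T : PatternTree (k + 1)) :
    T.firstParent.succ = T.parent 0 := by simp [firstParent]

end PatternTree

/-! ### Tree homomorphisms -/

section TreeHom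

variable {V : Type*} {G : SimpleGraph V}

/-- `f` maps the edges of the tree to edges of `G`. -/
def IsTreeHom {k : ℕ} (G : SimpleGraph V) (T : PatternTree k) (f : Fin (k + 1) → V) : Prop :=
  ∀ c : Fin k, G.Adj (f c.castSucc) (f (T.parent c))

lemma isTreeHom_cons {k : ℕ} (T : PatternTree (k + 1)) (j : V) (f : Fin (k + 1) → V) :
    IsTreeHom G T (Fin.cons j f) ↔ G.Adj j (f T.firstParent) ∧ IsTreeHom G T.tail f := by
  unfold IsTreeHom
  rw [Fin.forall_fin_succ]
  refine and_congr ?_ (forall_congr' fun c => ?_)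
  · rw [← T.succ_firstParent, Fin.cons_succ, Fin.castSucc_zero, Fin.cons_zero]
  · rw [← T.succ_tail_parent, Fin.cons_succ, Fin.castSucc_succ, Fin.cons_succ]

end TreeHom

/-! ### Weighted homomorphism counts and their noisy version -/

section HomSum

variable {V : Type*} [Fintype V] (G : SimpleGraph V) [DecidableRel G.Adj]

/-- The weighted number of homomorphisms of the pattern `T` into `G`, where a homomorphism `f` has
the weight `∏ ℓ, a ℓ (f ℓ)`. -/
def homSum : (k : ℕ) → PatternTree k → (Fin (k + 1) → V → ℝ) → ℝ
  | 0, _, a => ∑ i, a 0 i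
  | k + 1, T, a => homSum k T.tail (Function.update (fun ℓ => a ℓ.succ) T.firstParent
      fun i => a T.firstParent.succ i * ∑ j ∈ G.neighborFinset i, a 0 j)

/-- The bottom-up evaluation of the tree mechanism with mark indicators `χ`, initial counts `w` and
standard noise `z`. -/
def noisySum (ε : ℝ) : (k : ℕ) → PatternTree k → (χ w : Fin (k + 1) → V → ℝ) →
    (z : Fin k → V → ℝ) → ℝ
  | 0, _, χ, w, _ => ∑ i, χ 0 i * w 0 i
  | k + 1, T, χ, w, z => noisySum ε k T.tail (fun ℓ => χ ℓ.succ)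
      (Function.update (fun ℓ => w ℓ.succ) T.firstParent fun i => w T.firstParent.succ i *
        (∑ j ∈ G.neighborFinset i, χ 0 j * w 0 j + ‖w 0‖ / ε * z 0 i))
      (fun c => z c.succ)

variable {G}

open Classical in
-- Summing first over the image `j` of `u_0`, the only edge condition on `j` is adjacency to the
-- image of the parent. The sum over `j` is therefore the neighbourhood sum that `homSum` multiplies
-- into the weight of the parent.
theorem homSum_eq_sum {k : ℕ} (T : PatternTree k) (a : Fin (k + 1) → V → ℝ) :
    homSum G k T a = ∑ f : Fin (k + 1) → V, if IsTreeHom G T f then ∏ ℓ, a ℓ (f ℓ) else 0 := by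
  induction k with
  | zero =>
    rw [homSum, ← (Equiv.funUnique (Fin 1) V).symm.sum_comp]
    refine Finset.sum_congr rfl fun i _ => ?_
    have h : IsTreeHom G T ((Equiv.funUnique (Fin 1) V).symm i) := fun c => c.elim0
    rw [if_pos h]
    simp
  | succ k ih =>
    rw [homSum, ih, ← (Fin.consEquiv fun _ : Fin (k + 2) => V).sum_comp, Fintype.sum_prod_type, Finset.sum_comm]
    refine Finset.sum_congr rfl fun f _ => ?_
    have hc : ∀ j, IsTreeHom G T (Fin.consEquiv (fun _ : Fin (k + 2) => V) (j, f)) ↔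
        G.Adj j (f T.firstParent) ∧ IsTreeHom G T.tail f := fun j => isTreeHom_cons T j f
    have hP : ∀ j, ∏ ℓ, a ℓ (Fin.consEquiv (fun _ : Fin (k + 2) => V) (j, f) ℓ) =
        a 0 j * ∏ ℓ : Fin (k + 1), a ℓ.succ (f ℓ) := fun j => Fin.prod_univ_succ _
    simp only [hc, hP]
    by_cases hf : IsTreeHom G T.tail f
    · simp only [hf, if_true, and_true]
      have h1 : (fun ℓ => Function.update (fun ℓ : Fin (k + 1) => a ℓ.succ) T.firstParent
          (fun i => a T.firstParent.succ i * ∑ j ∈ G.neighborFinset i, a 0 j) ℓ (f ℓ)) =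
          Function.update (fun ℓ => a ℓ.succ (f ℓ)) T.firstParent
          (a T.firstParent.succ (f T.firstParent) *
            ∑ j ∈ G.neighborFinset (f T.firstParent), a 0 j) := by
        ext ℓ
        by_cases h : ℓ = T.firstParent
        · subst h; simp
        · simp [h]
      rw [h1, Finset.prod_update_of_mem (Finset.mem_univ _), mul_right_comm,
        ← Finset.erase_eq (s := Finset.univ),
        Finset.mul_prod_erase _ (fun ℓ : Fin (k + 1) => a ℓ.succ (f ℓ)) (Finset.mem_univ _),
        Finset.mul_sum, ← Finset.sum_filter]
      refine Finset.sum_congr ?_ fun j _ => ?_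
      · ext j; simp [G.adj_comm]
      · rw [mul_comm]
    · simp [hf]

/-- The weighted number of homomorphisms that map `u_p` to `i`, where `u_p` has weight `1`. -/
def homCoef {k : ℕ} (G : SimpleGraph V) [DecidableRel G.Adj] (T : PatternTree k)
    (a : Fin (k + 1) → V → ℝ) (p : Fin (k + 1)) (i : V) : ℝ :=
  open Classical in homSum G k T (Function.update a p (Pi.single i 1))

open Classical in
lemma homSum_update_eq_sum {k : ℕ} (T : PatternTree k) (a : Fin (k + 1) → V → ℝ)
    (p : Fin (k + 1)) (b : V → ℝ) :
    homSum G k T (Function.update a p b) = ∑ f : Fin (k + 1) → V, b (f p) *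
      if IsTreeHom G T f then ∏ ℓ ∈ Finset.univ \ {p}, a ℓ (f ℓ) else 0 := by
  rw [homSum_eq_sum]
  refine Finset.sum_congr rfl fun f _ => ?_
  have h1 : (fun ℓ => Function.update a p b ℓ (f ℓ)) =
      Function.update (fun ℓ => a ℓ (f ℓ)) p (b (f p)) := by
    ext ℓ
    by_cases h : ℓ = p
    · subst h; simp
    · simp [h]
  rw [h1, Finset.prod_update_of_mem (Finset.mem_univ _), mul_ite, mul_zero]

/-- Every homomorphism uses the weight of `u_p` exactly once, so the count is linear in it. This
exposes the coefficient with which noise added at `u_p` enters the final count. -/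
theorem homSum_update {k : ℕ} (T : PatternTree k) (a : Fin (k + 1) → V → ℝ)
    (p : Fin (k + 1)) (b : V → ℝ) :
    homSum G k T (Function.update a p b) = ∑ i, b i * homCoef G T a p i := by
  classical
  simp only [homCoef, homSum_update_eq_sum, Finset.mul_sum]
  rw [Finset.sum_comm]
  refine Finset.sum_congr rfl fun f _ => ?_
  rw [Finset.sum_eq_single (f p)]
  · simp
  · intro i _ hi; simp [Ne.symm hi]
  · simp

lemma abs_homSum_le {k : ℕ} (T : PatternTree k) (a : Fin (k + 1) → V → ℝ) :
    |homSum G k T a| ≤ homSum G k T fun ℓ i => |a ℓ i| := by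
  classical
  rw [homSum_eq_sum, homSum_eq_sum]
  refine (Finset.abs_sum_le_sum_abs _ _).trans (Finset.sum_le_sum fun f _ => ?_)
  split_ifs <;> simp [Finset.abs_prod]

lemma prod_update_mul {k : ℕ} (F : Fin (k + 2) → ℝ) (p : Fin (k + 1)) (x : ℝ) :
    ∏ ℓ, Function.update (fun ℓ : Fin (k + 1) => F ℓ.succ) p (F p.succ * x) ℓ =
      (∏ ℓ : Fin (k + 1), F ℓ.succ) * x := by
  rw [Finset.prod_update_of_mem (Finset.mem_univ _), mul_right_comm,
    ← Finset.erase_eq (s := Finset.univ),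
    Finset.mul_prod_erase _ (fun ℓ : Fin (k + 1) => F ℓ.succ) (Finset.mem_univ _)]

/-- Homomorphisms of a tree are counted by choosing the image of an arbitrary vertex `u_s` and then
extending along the edges. -/
theorem homSum_le_prod {k : ℕ} (T : PatternTree k) (a : Fin (k + 1) → V → ℝ)
    (F : Fin (k + 1) → ℝ) (s : Fin (k + 1)) (ha : ∀ ℓ i, 0 ≤ a ℓ i) (hF : ∀ ℓ, 0 ≤ F ℓ)
    (hs : ∑ i, a s i ≤ F s) (h : ∀ ℓ, ℓ ≠ s → ∀ i, ∑ j ∈ G.neighborFinset i, a ℓ j ≤ F ℓ) :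
    homSum G k T a ≤ ∏ ℓ, F ℓ := by
  classical
  induction k with
  | zero =>
    obtain rfl : s = 0 := Fin.fin_one_eq_zero s
    simpa [homSum] using hs
  | succ k ih =>
    set p := T.firstParent
    have hF' : ∏ ℓ, Function.update (fun ℓ : Fin (k + 1) => F ℓ.succ) p (F p.succ * F 0) ℓ =
        ∏ ℓ, F ℓ := by
      rw [prod_update_mul, Fin.prod_univ_succ F, mul_comm]
    rw [← hF']
    change homSum G k T.tail (Function.update (fun ℓ : Fin (k + 1) => a ℓ.succ) p
      fun i => a p.succ i * ∑ j ∈ G.neighborFinset i, a 0 j) ≤ _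
    have ha' : ∀ ℓ i, 0 ≤ Function.update (fun ℓ : Fin (k + 1) => a ℓ.succ) p
        (fun i => a p.succ i * ∑ j ∈ G.neighborFinset i, a 0 j) ℓ i := by
      intro ℓ i
      by_cases hp : ℓ = p
      · subst hp
        simpa using mul_nonneg (ha _ _) (Finset.sum_nonneg fun j _ => ha 0 j)
      · simpa [hp] using ha _ _
    have hF0 : ∀ ℓ, 0 ≤ Function.update (fun ℓ : Fin (k + 1) => F ℓ.succ) p (F p.succ * F 0) ℓ := by
      intro ℓ
      by_cases hp : ℓ = p
      · subst hp
        simpa using mul_nonneg (hF _) (hF _)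
      · simpa [hp] using hF _
    refine Fin.cases (fun hs h => ?_) (fun s hs h => ?_) s hs h
    -- Here the starting vertex is the one being removed. The start moves to its parent, and the sum
    -- over adjacent pairs is regrouped by the image of `u_0`.
    · refine ih T.tail _ _ p ha' hF0 ?_ fun ℓ hp i => ?_
      · simp only [Function.update_self]
        calc ∑ i, a p.succ i * ∑ j ∈ G.neighborFinset i, a 0 j
            = ∑ j, a 0 j * ∑ i ∈ G.neighborFinset j, a p.succ i := by
              simp only [Finset.mul_sum, SimpleGraph.neighborFinset_eq_filter, Finset.sum_filter]
              rw [Finset.sum_comm]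
              refine Finset.sum_congr rfl fun j _ => Finset.sum_congr rfl fun i _ => ?_
              simp [G.adj_comm i j, mul_comm]
          _ ≤ ∑ j, a 0 j * F p.succ := Finset.sum_le_sum fun j _ =>
              mul_le_mul_of_nonneg_left (h _ (Fin.succ_ne_zero _) j) (ha _ _)
          _ ≤ F p.succ * F 0 := by
              rw [← Finset.sum_mul, mul_comm]
              exact mul_le_mul_of_nonneg_left hs (hF _)
      · simpa [hp] using h ℓ.succ (Fin.succ_ne_zero _) i
    · have h0 : ∀ i, ∑ j ∈ G.neighborFinset i, a 0 j ≤ F 0 := h 0 (Fin.succ_ne_zero _).symm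
      have key : ∀ S : Finset V, ∑ i ∈ S, a p.succ i ≤ F p.succ →
          ∑ i ∈ S, a p.succ i * ∑ j ∈ G.neighborFinset i, a 0 j ≤ F p.succ * F 0 := fun S hS =>
        calc ∑ i ∈ S, a p.succ i * ∑ j ∈ G.neighborFinset i, a 0 j
            ≤ ∑ i ∈ S, a p.succ i * F 0 := Finset.sum_le_sum fun i _ =>
              mul_le_mul_of_nonneg_left (h0 i) (ha _ _)
          _ ≤ F p.succ * F 0 := by
              rw [← Finset.sum_mul]
              exact mul_le_mul_of_nonneg_right hS (hF _)
      refine ih T.tail _ _ s ha' hF0 ?_ fun ℓ hℓ i => ?_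
      · by_cases hp : s = p
        · subst hp
          simpa using key _ hs
        · simpa [hp] using hs
      · by_cases hp : ℓ = p
        · subst hp
          simpa using key _ (h _ (fun h' => hℓ (Fin.succ_injective _ h')) i)
        · simpa [hp] using h ℓ.succ (fun h' => hℓ (Fin.succ_injective _ h')) i

lemma continuous_noisySum {X : Type*} [TopologicalSpace X] (ε : ℝ) {k : ℕ} (T : PatternTree k)
    (χ : Fin (k + 1) → V → ℝ) (w : X → Fin (k + 1) → V → ℝ) (z : X → Fin k → V → ℝ)
    (hw : Continuous w) (hz : Continuous z) :
    Continuous fun x => noisySum G ε k T χ (w x) (z x) := by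
  induction k with
  | zero => simp only [noisySum]; fun_prop
  | succ k ih =>
    simp only [noisySum]
    refine ih _ _ _ _ ?_ (by fun_prop)
    refine Continuous.update (by fun_prop) _ ?_
    fun_prop

/-- The mechanism never exceeds the product of the crude bounds on the noisy messages. -/
lemma abs_noisySum_le {ε : ℝ} (hε : 0 < ε) {k : ℕ} (T : PatternTree k)
    (χ w : Fin (k + 1) → V → ℝ) (z : Fin k → V → ℝ) (M : Fin (k + 1) → ℝ)
    (hχ : ∀ ℓ i, |χ ℓ i| ≤ 1) (hw : ∀ ℓ i, |w ℓ i| ≤ M ℓ) (hM : ∀ ℓ, 0 ≤ M ℓ) :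
    |noisySum G ε k T χ w z| ≤
      Fintype.card V * (∏ ℓ, M ℓ) * ∏ c, (Fintype.card V + (∑ i, |z c i|) / ε) := by
  induction k with
  | zero =>
    have hM0 : ∏ ℓ, M ℓ = M 0 := Fin.prod_univ_one M
    rw [hM0, Fin.prod_univ_zero, mul_one]
    simp only [noisySum]
    refine (Finset.abs_sum_le_sum_abs _ _).trans
      ((Finset.sum_le_sum (g := fun _ => M 0) fun i _ => ?_).trans (by simp))
    rw [abs_mul]
    simpa using mul_le_mul (hχ 0 i) (hw 0 i) (abs_nonneg _) zero_le_one
  | succ k ih =>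
    set D : ℝ := Fintype.card V + (∑ i, |z 0 i|) / ε
    have hD : 0 ≤ D := add_nonneg (by positivity)
      (div_nonneg (Finset.sum_nonneg fun _ _ => abs_nonneg _) hε.le)
    have hg : ∀ i, |∑ j ∈ G.neighborFinset i, χ 0 j * w 0 j + ‖w 0‖ / ε * z 0 i| ≤ M 0 * D := by
      intro i
      refine (abs_add_le _ _).trans ?_
      rw [mul_add]
      refine add_le_add ?_ ?_
      · calc |∑ j ∈ G.neighborFinset i, χ 0 j * w 0 j|
            ≤ ∑ j ∈ G.neighborFinset i, |χ 0 j * w 0 j| := Finset.abs_sum_le_sum_abs _ _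
          _ ≤ ∑ j, |χ 0 j * w 0 j| := Finset.sum_le_univ_sum_of_nonneg fun _ => abs_nonneg _
          _ ≤ ∑ _j : V, M 0 := Finset.sum_le_sum fun j _ => by
              rw [abs_mul]
              simpa using mul_le_mul (hχ 0 j) (hw 0 j) (abs_nonneg _) zero_le_one
          _ = M 0 * Fintype.card V := by simp [mul_comm]
      · have h1 : ‖w 0‖ ≤ M 0 := (pi_norm_le_iff_of_nonneg (hM 0)).2 fun i => hw 0 i
        have h2 : |z 0 i| ≤ ∑ i, |z 0 i| :=
          Finset.single_le_sum (f := fun i => |z 0 i|) (fun _ _ => abs_nonneg _)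
            (Finset.mem_univ i)
        rw [abs_mul, abs_of_nonneg (by positivity), div_mul_eq_mul_div, mul_div_assoc]
        have := hM 0
        gcongr
    simp only [noisySum]
    refine (ih T.tail (fun ℓ => χ ℓ.succ) _ (fun c => z c.succ)
      (Function.update (fun ℓ : Fin (k + 1) => M ℓ.succ) T.firstParent
        (M T.firstParent.succ * (M 0 * D))) (fun ℓ i => hχ _ _) ?_ ?_).trans (le_of_eq ?_)
    · intro ℓ i
      by_cases hp : ℓ = T.firstParent
      · subst hp
        simp only [Function.update_self, abs_mul]
        exact mul_le_mul (hw _ _) (hg i) (abs_nonneg _) (hM _)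
      · simpa [hp] using hw _ _
    · intro ℓ
      by_cases hp : ℓ = T.firstParent
      · subst hp
        simpa using mul_nonneg (hM _) (mul_nonneg (hM _) hD)
      · simpa [hp] using hM _
    · rw [prod_update_mul, Fin.prod_univ_succ M,
        Fin.prod_univ_succ fun c => (Fintype.card V : ℝ) + (∑ i, |z c i|) / ε]
      ring

end HomSum

/-! ### The execution as a recursion along the tree -/

section Execution

variable {V : Type*} [Fintype V] (G : SimpleGraph V) [DecidableRel G.Adj]

/-- The indicators of the marks. -/
def markInd {k : ℕ} {V : Type*} (r : V → Fin (k + 1)) (ℓ : Fin (k + 1)) (i : V) : ℝ :=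
  if r i = ℓ then 1 else 0

/-- The initial counts: `1` for leaves, and the indicator of the mark for other vertices. -/
def initCount {k : ℕ} {V : Type*} (T : PatternTree k) (r : V → Fin (k + 1)) (ℓ : Fin (k + 1))
    (i : V) : ℝ :=
  if ℓ ∈ T.leaves then 1 else markInd r ℓ i

variable {k : ℕ} (T : PatternTree k) (ε : ℝ)

open LocalMechanism

lemma treeMechanism_randomizer (ℓ : Fin (k + 1)) (i : V) (S : Finset V)
    (seed : Fin (k + 1) × (Fin k → ℝ)) (B : (r : Option (Fin (k + 1))) → V → TreeMsg k r) :
    ((treeMechanism T ε V).randomizer (some ℓ) i S seed B : ℝ) =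
      if (B none i : Fin (k + 1)) = ℓ then
        ∏ c ∈ T.children ℓ,
          ((∑ j ∈ S, if (B none j : Fin (k + 1)) = c.castSucc then (B (some c.castSucc) j : ℝ)
            else 0) + ‖(B (some c.castSucc) : V → ℝ)‖ / ε * seed.2 c)
      else 0 := rfl

/-- Executing the rounds of a strictly increasing list of tree vertices. -/
lemma treeMechanism_foldl (ω : V → Fin (k + 1) × (Fin k → ℝ)) (l : List (Fin (k + 1)))
    (hl : l.Pairwise (· < ·)) (B : (r : Option (Fin (k + 1))) → V → TreeMsg k r) :
    let B' := (l.map some).foldl ((treeMechanism T ε V).step G ω) B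
    B' none = B none ∧ (∀ ℓ ∉ l, B' (some ℓ) = B (some ℓ)) ∧ ∀ ℓ ∈ l, ∀ i,
      (B' (some ℓ) i : ℝ) = (treeMechanism T ε V).randomizer (some ℓ) i (G.neighborFinset i)
        (ω i) B' := by
  induction l generalizing B with
  | nil => simp
  | cons m l ih =>
    rw [List.pairwise_cons] at hl
    obtain ⟨hm, hl⟩ := hl
    have hml : m ∉ l := fun h => lt_irrefl _ (hm m h)
    set B₁ := (treeMechanism T ε V).step G ω B (some m) with hB₁
    obtain ⟨h1, h2, h3⟩ := ih hl B₁
    have hB₁n : B₁ none = B none := by simp [hB₁, step]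
    have hB₁o : ∀ ℓ, ℓ ≠ m → B₁ (some ℓ) = B (some ℓ) := fun ℓ h => by simp [hB₁, step, h]
    simp only [List.map_cons, List.foldl_cons]
    refine ⟨h1.trans hB₁n, fun ℓ hℓ => ?_, fun ℓ hℓ i => ?_⟩
    · rw [List.mem_cons, not_or] at hℓ
      exact (h2 ℓ hℓ.2).trans (hB₁o ℓ hℓ.1)
    · rcases List.mem_cons.1 hℓ with rfl | hℓ
      · rw [h2 ℓ hml]
        have hval : B₁ (some ℓ) i = (treeMechanism T ε V).randomizer (some ℓ) i
            (G.neighborFinset i) (ω i) B := by simp [hB₁, step]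
        rw [hval, treeMechanism_randomizer, treeMechanism_randomizer, h1, hB₁n]
        -- The message was computed from the transcript at that time. Children precede `ℓ` and all
        -- later rounds lie above `ℓ`, so the counts that were read are already final.
        refine if_congr Iff.rfl (Finset.prod_congr rfl fun c hc => ?_) rfl
        have hcl : c.castSucc < ℓ := by
          have := T.lt_parent c
          rw [PatternTree.children, Finset.mem_filter] at hc
          exact hc.2 ▸ this
        rw [h2 c.castSucc fun h => (hm _ h).not_gt hcl, hB₁o _ hcl.ne]
      · exact h3 ℓ hℓ i

/-- The counts of an execution satisfy the recursion of the mechanism. -/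
lemma exists_counts (ω : V → Fin (k + 1) × (Fin k → ℝ)) :
    ∃ X : Fin (k + 1) → V → ℝ,
      (∀ ℓ i, X ℓ i = initCount T (fun i => (ω i).1) ℓ i * ∏ c ∈ T.children ℓ,
        (∑ j ∈ G.neighborFinset i, markInd (fun i => (ω i).1) c.castSucc j * X c.castSucc j
          + ‖X c.castSucc‖ / ε * (ω i).2 c)) ∧
      (treeMechanism T ε V).output G ω = ((k : ℝ) + 1) ^ (k + 1) *
        ∑ i, markInd (fun i => (ω i).1) (Fin.last k) i * X (Fin.last k) i := by
  set M := treeMechanism T ε V with hM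
  set B₁ := M.step G ω M.init none with hB₁
  obtain ⟨h1, h2, h3⟩ := treeMechanism_foldl G T ε ω (T.internals.sort (· ≤ ·))
    (Finset.sortedLT_sort _).pairwise B₁
  set B' := ((T.internals.sort (· ≤ ·)).map some).foldl (M.step G ω) B₁ with hB'
  have hB : M.transcript G ω = B' := rfl
  have hmark : B' none = fun i => (ω i).1 := by
    rw [h1, hB₁]; simp [step, hM, treeMechanism]
  refine ⟨fun ℓ => B' (some ℓ), fun ℓ i => ?_, ?_⟩
  · change B' (some ℓ) i = _
    by_cases hℓ : ℓ ∈ T.leaves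
    · have hc : T.children ℓ = ∅ := by simpa [PatternTree.leaves] using hℓ
      rw [h2 ℓ (by simp [PatternTree.internals, hc]), hc, Finset.prod_empty, initCount, if_pos hℓ,
        hB₁]
      simp [step, hM, treeMechanism, hℓ]
    · have hc : T.children ℓ ≠ ∅ := by simpa [PatternTree.leaves] using hℓ
      rw [h3 ℓ (by simp [PatternTree.internals, hc]) i, initCount, if_neg hℓ,
        treeMechanism_randomizer, hmark]
      simp only [markInd, ite_mul, one_mul, zero_mul]
  · rw [output, hB]
    simp only [hM, treeMechanism]
    rw [hmark]
    simp only [markInd, ite_mul, one_mul, zero_mul]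

variable {T}

lemma PatternTree.children_zero (T : PatternTree k) : T.children 0 = ∅ := by
  simp [PatternTree.children, T.parent_ne_zero]

lemma PatternTree.prod_children_succ (T : PatternTree (k + 1)) (ℓ : Fin (k + 1))
    (g : Fin (k + 1) → ℝ) :
    ∏ c ∈ T.children ℓ.succ, g c =
      (if ℓ = T.firstParent then g 0 else 1) * ∏ c ∈ T.tail.children ℓ, g c.succ := by
  rw [PatternTree.children, PatternTree.children, Finset.prod_filter, Finset.prod_filter,
    Fin.prod_univ_succ, ← T.succ_firstParent]
  congr 1
  · simp [eq_comm]
  · refine Finset.prod_congr rfl fun c _ => if_congr ?_ rfl rfl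
    rw [← T.succ_tail_parent, Fin.succ_inj]

/-- Solving the recursion of the counts bottom-up. -/
lemma sum_eq_noisySum {k : ℕ} (T : PatternTree k) (χ w X : Fin (k + 1) → V → ℝ)
    (z : Fin k → V → ℝ)
    (hX : ∀ ℓ i, X ℓ i = w ℓ i * ∏ c ∈ T.children ℓ,
        (∑ j ∈ G.neighborFinset i, χ c.castSucc j * X c.castSucc j
          + ‖X c.castSucc‖ / ε * z c i)) :
    ∑ i, χ (Fin.last k) i * X (Fin.last k) i = noisySum G ε k T χ w z := by
  induction k with
  | zero =>
    rw [noisySum]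
    refine Finset.sum_congr rfl fun i _ => ?_
    rw [hX]
    simp [PatternTree.children]
  | succ k ih =>
    have h0 : X 0 = w 0 := by
      ext i
      rw [hX, T.children_zero, Finset.prod_empty, mul_one]
    rw [noisySum, ← ih T.tail (fun ℓ => χ ℓ.succ) _ (fun ℓ => X ℓ.succ) (fun c => z c.succ),
      Fin.succ_last]
    intro ℓ i
    rw [hX, T.prod_children_succ, ← mul_assoc]
    simp only [Fin.castSucc_zero, h0, Fin.castSucc_succ]
    congr 1
    by_cases h : ℓ = T.firstParent
    · subst h; simp
    · simp [h]

/-- The output of the mechanism as a noisy weighted count of marked homomorphisms. -/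
theorem output_eq_noisySum (T : PatternTree k) (ω : V → Fin (k + 1) × (Fin k → ℝ)) :
    (treeMechanism T ε V).output G ω = ((k : ℝ) + 1) ^ (k + 1) *
      noisySum G ε k T (markInd fun i => (ω i).1) (initCount T fun i => (ω i).1)
        (fun c i => (ω i).2 c) := by
  obtain ⟨X, hX, hout⟩ := exists_counts G T ε ω
  rw [hout, sum_eq_noisySum G ε T _ _ X (fun c i => (ω i).2 c) hX]

theorem treeMechanism_rounds (T : PatternTree k) :
    (treeMechanism T ε V).rounds = k + 2 - T.leaves.card := by
  have h : T.leaves.card + T.internals.card = k + 1 := by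
    have := Finset.card_filter_add_card_filter_not (s := Finset.univ)
      (fun ℓ => T.children ℓ = ∅)
    simpa [PatternTree.leaves, PatternTree.internals] using this
  simp only [rounds, treeMechanism, List.length_cons, List.length_map, Finset.length_sort]
  omega

end Execution

/-! ### Moments of the Laplace distribution -/

section Laplace

open Real

lemma integral_exp_neg_mul_abs {b : ℝ} (hb : 0 < b) : ∫ x : ℝ, exp (-b * |x|) = 2 / b := by
  rw [integral_comp_abs (f := fun x => exp (-b * x)), integral_exp_mul_Ioi (by linarith)]
  simp
  ring

lemma integrable_exp_neg_mul_abs {b : ℝ} (hb : 0 < b) :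
    Integrable fun x : ℝ => exp (-b * |x|) := by
  refine Integrable.of_integral_ne_zero ?_
  rw [integral_exp_neg_mul_abs hb]
  positivity

lemma integral_laplaceStd (f : ℝ → ℝ) :
    ∫ x, f x ∂laplaceStd = ∫ x, exp (-|x|) / 2 * f x := by
  rw [laplaceStd, integral_withDensity_eq_integral_toReal_smul (by fun_prop) (by simp)]
  refine integral_congr_ae (Filter.Eventually.of_forall fun x => ?_)
  simp only [smul_eq_mul]
  rw [ENNReal.toReal_ofReal (by positivity)]

lemma integrable_laplaceStd_iff (f : ℝ → ℝ) :
    Integrable f laplaceStd ↔ Integrable fun x => exp (-|x|) / 2 * f x := by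
  rw [laplaceStd, integrable_withDensity_iff_integrable_smul' (by fun_prop) (by simp)]
  refine integrable_congr (Filter.Eventually.of_forall fun x => ?_)
  simp only [smul_eq_mul]
  rw [ENNReal.toReal_ofReal (by positivity)]

instance : IsProbabilityMeasure laplaceStd := by
  constructor
  rw [laplaceStd, withDensity_apply _ MeasurableSet.univ, Measure.restrict_univ,
    ← ofReal_integral_eq_lintegral_ofReal]
  · rw [integral_div]
    have := integral_exp_neg_mul_abs one_pos
    simp only [neg_one_mul] at this
    rw [this]
    simp
  · have := integrable_exp_neg_mul_abs one_pos
    simp only [neg_one_mul] at this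
    exact this.div_const 2
  · exact Filter.Eventually.of_forall fun x => by positivity

lemma exp_mul_exp_abs (s x : ℝ) :
    exp (-|x|) / 2 * exp (s * |x|) = exp (-(1 - s) * |x|) / 2 := by
  rw [div_mul_eq_mul_div, ← exp_add]
  ring_nf

lemma integrable_exp_abs_laplaceStd {s : ℝ} (hs : s < 1) :
    Integrable (fun x => exp (s * |x|)) laplaceStd := by
  rw [integrable_laplaceStd_iff]
  simp only [exp_mul_exp_abs]
  exact (integrable_exp_neg_mul_abs (by linarith)).div_const 2

lemma integral_exp_abs_laplaceStd {s : ℝ} (hs : s < 1) :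
    ∫ x, exp (s * |x|) ∂laplaceStd = 1 / (1 - s) := by
  rw [integral_laplaceStd]
  simp only [exp_mul_exp_abs]
  rw [integral_div, integral_exp_neg_mul_abs (by linarith)]
  ring

lemma integral_laplaceStd_neg (f : ℝ → ℝ) :
    ∫ x, f (-x) ∂laplaceStd = ∫ x, f x ∂laplaceStd := by
  rw [integral_laplaceStd, integral_laplaceStd,
    ← integral_neg_eq_self fun x => exp (-|x|) / 2 * f x]
  simp

lemma integrable_abs_laplaceStd : Integrable (fun x => |x|) laplaceStd := by
  refine ((integrable_exp_abs_laplaceStd (s := 1 / 2) (by norm_num)).const_mul 2).mono'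
    (by fun_prop) (Filter.Eventually.of_forall fun x => ?_)
  have := add_one_le_exp (1 / 2 * |x|)
  rw [norm_eq_abs, abs_abs]
  linarith

lemma integrable_id_laplaceStd : Integrable (fun x : ℝ => x) laplaceStd :=
  integrable_abs_laplaceStd.mono (by fun_prop) (Filter.Eventually.of_forall fun x => by simp)

lemma integral_id_laplaceStd : ∫ x, x ∂laplaceStd = 0 := by
  have := integral_laplaceStd_neg fun x => x
  rw [integral_neg] at this
  linarith

lemma integrable_exp_laplaceStd {s : ℝ} (hs : |s| < 1) :
    Integrable (fun x => exp (s * x)) laplaceStd := by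
  refine (integrable_exp_abs_laplaceStd hs).mono' (by fun_prop)
    (Filter.Eventually.of_forall fun x => ?_)
  rw [norm_eq_abs, abs_exp, ← abs_mul]
  exact exp_le_exp.2 (le_abs_self _)

/-- By symmetry `exp (s x)` may be averaged with `exp (-s x)`. This average depends only on `|x|`,
so the answer is the mean of `1/(1-s)` and `1/(1+s)`. -/
lemma integral_exp_laplaceStd {s : ℝ} (hs : |s| < 1) :
    ∫ x, exp (s * x) ∂laplaceStd = 1 / (1 - s ^ 2) := by
  have hs' := abs_lt.1 hs
  have h1 := integral_laplaceStd_neg fun x => exp (s * x)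
  have h2 : ∫ x, (exp (s * x) + exp (s * -x)) ∂laplaceStd =
      ∫ x, (exp (s * |x|) + exp (-s * |x|)) ∂laplaceStd := by
    refine integral_congr_ae (Filter.Eventually.of_forall fun x => ?_)
    rcases abs_choice x with h | h <;> simp only [h]
    · ring_nf
    · rw [add_comm]; ring_nf
  rw [integral_add (integrable_exp_laplaceStd hs) (by
      simpa using integrable_exp_laplaceStd (s := -s) (by simpa using hs)),
    integral_add (integrable_exp_abs_laplaceStd hs'.2)
      (integrable_exp_abs_laplaceStd (by linarith)), h1,
    integral_exp_abs_laplaceStd hs'.2, integral_exp_abs_laplaceStd (by linarith)] at h2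
  have h3 : 1 - s ≠ 0 := by linarith
  have h4 : 1 + s ≠ 0 := by linarith
  have h5 : 1 - s ^ 2 = (1 - s) * (1 + s) := by ring
  have h6 : (1 : ℝ) / (1 - s) + 1 / (1 - -s) = 2 * (1 / ((1 - s) * (1 + s))) := by
    rw [sub_neg_eq_add]; field_simp; ring
  rw [h5]
  linarith

/-- The moment generating function of the Laplace distribution is subgaussian near `0`. -/
lemma integral_exp_laplaceStd_le {s : ℝ} (hs : s ^ 2 ≤ 1 / 2) :
    ∫ x, exp (s * x) ∂laplaceStd ≤ exp (2 * s ^ 2) := by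
  have h : |s| < 1 := (sq_lt_one_iff_abs_lt_one s).1 (by linarith)
  rw [integral_exp_laplaceStd h, div_le_iff₀ (by linarith)]
  -- It suffices that `(1 + 2s²)(1 - s²) = 1 + s²(1 - 2s²) ≥ 1`, which is where `s² ≤ 1/2` enters.
  have := add_one_le_exp (2 * s ^ 2)
  nlinarith [sq_nonneg s]

end Laplace

/-! ### Joint laws of marks and noise -/

section Laws

open ProbabilityTheory

/-- The joint law of the marks. -/
def markLaw (V : Type*) [Fintype V] (k : ℕ) : Measure (V → Fin (k + 1)) :=
  Measure.pi fun _ => (PMF.uniformOfFintype (Fin (k + 1))).toMeasure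

/-- The joint law of the standard noise of all nodes for one child. -/
def noiseVec (V : Type*) [Fintype V] : Measure (V → ℝ) := Measure.pi fun _ => laplaceStd

/-- The joint law of all standard noise. -/
def noiseLaw (V : Type*) [Fintype V] (k : ℕ) : Measure (Fin k → V → ℝ) :=
  Measure.pi fun _ => noiseVec V

variable {V : Type*} [Fintype V]

instance (k : ℕ) : IsProbabilityMeasure (markLaw V k) := by unfold markLaw; infer_instance
instance : IsProbabilityMeasure (noiseVec V) := by unfold noiseVec; infer_instance
instance (k : ℕ) : IsProbabilityMeasure (noiseLaw V k) := by unfold noiseLaw; infer_instance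

/-- The seeds list the noise node by node, while the recursion consumes it tree vertex by tree
vertex. Boxes whose sides are boxes form a generating π-system, transposition sends such boxes to
each other, and the two double products of measures agree. -/
lemma measurePreserving_pi_swap {ι κ : Type*} [Fintype ι] [Fintype κ] (μ : Measure ℝ)
    [IsProbabilityMeasure μ] :
    MeasurePreserving (fun (x : ι → κ → ℝ) c i => x i c)
      (Measure.pi fun _ => Measure.pi fun _ => μ) (Measure.pi fun _ => Measure.pi fun _ => μ) := by
  have hm : Measurable fun (x : ι → κ → ℝ) c i => x i c := by fun_prop
  refine ⟨hm, ?_⟩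
  symm
  refine Measure.pi_eq_generateFrom
    (C := fun _ => Set.pi Set.univ '' Set.pi Set.univ fun _ : ι => {s : Set ℝ | MeasurableSet s})
    (fun _ => generateFrom_pi) (fun _ => isPiSystem_pi) (fun _ => ?_) ?_
  · exact ⟨fun _ => Set.univ, fun _ => ⟨fun _ => Set.univ, by simp, by simp⟩, by simp,
      Set.iUnion_const _⟩
  · intro s hs
    choose t ht hts using hs
    have hpre : (fun (x : ι → κ → ℝ) c i => x i c) ⁻¹' Set.pi Set.univ s =
        Set.pi Set.univ fun i => Set.pi Set.univ fun c => t c i := by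
      ext x
      simp only [Set.mem_preimage, Set.mem_pi, ← hts]
      exact ⟨fun h i _ c _ => h c trivial i trivial, fun h c _ i _ => h i trivial c trivial⟩
    rw [Measure.map_apply hm (MeasurableSet.univ_pi fun c => by
      rw [← hts]; exact MeasurableSet.univ_pi fun i => ht c i trivial), hpre, Measure.pi_pi]
    simp only [Measure.pi_pi, ← hts]
    exact Finset.prod_comm

/-- The marks and the noise are independent. -/
theorem measurePreserving_seeds {k : ℕ} (T : PatternTree k) (ε : ℝ) :
    MeasurePreserving (fun ω : V → Fin (k + 1) × (Fin k → ℝ) =>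
        ((fun i => (ω i).1 : V → Fin (k + 1)), fun c i => (ω i).2 c))
      (treeMechanism T ε V).law ((markLaw V k).prod (noiseLaw V k)) := by
  have h1 := measurePreserving_arrowProdEquivProdArrow (Fin (k + 1)) (Fin k → ℝ) V
    (fun _ => (PMF.uniformOfFintype (Fin (k + 1))).toMeasure)
    (fun _ => Measure.pi fun _ => laplaceStd)
  exact ((MeasurePreserving.id (markLaw V k)).prod (measurePreserving_pi_swap laplaceStd)).comp h1

lemma measurePreserving_cons (k : ℕ) :
    MeasurePreserving (fun p : (V → ℝ) × (Fin k → V → ℝ) => (Fin.cons p.1 p.2 : Fin (k + 1) → V → ℝ))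
      ((noiseVec V).prod (noiseLaw V k)) (noiseLaw V (k + 1)) := by
  have h := (measurePreserving_piFinSuccAbove (fun _ : Fin (k + 1) => noiseVec V) 0).symm
  have he : ⇑(MeasurableEquiv.piFinSuccAbove (fun _ : Fin (k + 1) => V → ℝ) 0).symm =
      fun p => Fin.cons p.1 p.2 := by
    ext p c i
    simp [MeasurableEquiv.piFinSuccAbove, Fin.insertNthEquiv]
  rw [he] at h
  exact h

end Laws

/-! ### The noise has mean zero -/

section Unbiased

variable {V : Type*} [Fintype V] {G : SimpleGraph V} [DecidableRel G.Adj]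

lemma integrable_noiseVec_comp {f : ℝ → ℝ} (hf : Integrable f laplaceStd) (i : V) :
    Integrable (fun z : V → ℝ => f (z i)) (noiseVec V) :=
  (measurePreserving_eval (fun _ : V => laplaceStd) i).integrable_comp_of_integrable hf

lemma integral_noiseVec_comp (f : ℝ → ℝ) (hf : AEStronglyMeasurable f laplaceStd) (i : V) :
    ∫ z, f (z i) ∂noiseVec V = ∫ x, f x ∂laplaceStd := by
  have h := measurePreserving_eval (fun _ : V => laplaceStd) i
  have := integral_map (φ := Function.eval i) h.aemeasurable (f := f) (by rw [h.map_eq]; exact hf)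
  rw [h.map_eq] at this
  exact this.symm

/-- This is the dominating function from `abs_noisySum_le`. It is a product of functions of
independent noise vectors, so integrability of each factor suffices. -/
lemma integrable_noise_bound (ε : ℝ) (k : ℕ) :
    Integrable (fun z : Fin k → V → ℝ => ∏ c, ((Fintype.card V : ℝ) + (∑ i, |z c i|) / ε))
      (noiseLaw V k) :=
  Integrable.fintype_prod (f := fun _ (y : V → ℝ) => (Fintype.card V : ℝ) + (∑ i, |y i|) / ε)
    fun _ => (integrable_const _).add
      ((integrable_finsetSum _ fun i _ =>
        integrable_noiseVec_comp integrable_abs_laplaceStd i).div_const ε)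

lemma integrable_noisySum {ε : ℝ} (hε : 0 < ε) {k : ℕ} (T : PatternTree k)
    (χ w : Fin (k + 1) → V → ℝ) (hχ : ∀ ℓ i, |χ ℓ i| ≤ 1) :
    Integrable (fun z => noisySum G ε k T χ w z) (noiseLaw V k) := by
  refine ((integrable_noise_bound ε k).const_mul
    (Fintype.card V * ∏ ℓ, ‖w ℓ‖)).mono' ?_ (Filter.Eventually.of_forall fun z => ?_)
  · exact (continuous_noisySum ε T χ (fun _ => w) (fun z => z) continuous_const
      continuous_id).aestronglyMeasurable
  · exact abs_noisySum_le hε T χ w z _ hχ (fun ℓ i => norm_le_pi_norm (w ℓ) i)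
      fun ℓ => norm_nonneg _

/-- Writing a weight at one vertex into the mark indicators. -/
lemma mul_update {ι V : Type*} [DecidableEq ι] (χ w : ι → V → ℝ) (p : ι) (b : V → ℝ) :
    (fun ℓ i => χ ℓ i * Function.update w p b ℓ i) =
      Function.update (fun ℓ i => χ ℓ i * w ℓ i) p fun i => χ p i * b i := by
  ext ℓ i
  by_cases h : ℓ = p
  · subst h; simp
  · simp [h]

/-- One step of the recursion separates the noise of the first vertex. -/
lemma homSum_tail_eq {k : ℕ} (T : PatternTree (k + 1)) (χ w : Fin (k + 2) → V → ℝ)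
    (y : V → ℝ) :
    homSum G k T.tail (fun ℓ i => χ ℓ.succ i *
      Function.update (fun ℓ => w ℓ.succ) T.firstParent (fun i => w T.firstParent.succ i *
        (∑ j ∈ G.neighborFinset i, χ 0 j * w 0 j + y i)) ℓ i) =
      homSum G (k + 1) T (fun ℓ i => χ ℓ i * w ℓ i) +
        ∑ i, χ T.firstParent.succ i * w T.firstParent.succ i * y i *
          homCoef G T.tail (fun ℓ i => χ ℓ.succ i * w ℓ.succ i) T.firstParent i := by
  rw [mul_update (fun ℓ : Fin (k + 1) => χ ℓ.succ), homSum_update, homSum, homSum_update,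
    ← Finset.sum_add_distrib]
  exact Finset.sum_congr rfl fun i _ => by ring

/-- The noise of `u_0` is integrated last. The induction hypothesis handles all later noise although
its scales depend on that of `u_0`, and by `homSum_tail_eq` what remains is affine in centred
variables. -/
theorem integral_noisySum {ε : ℝ} (hε : 0 < ε) {k : ℕ} (T : PatternTree k)
    (χ w : Fin (k + 1) → V → ℝ) (hχ : ∀ ℓ i, |χ ℓ i| ≤ 1) :
    ∫ z, noisySum G ε k T χ w z ∂noiseLaw V k = homSum G k T fun ℓ i => χ ℓ i * w ℓ i := by
  induction k with
  | zero => simp [noisySum, homSum]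
  | succ k ih =>
    have hmp := measurePreserving_cons (V := V) k
    have hint := integrable_noisySum (G := G) hε T χ w hχ
    have hint' : Integrable (fun p : (V → ℝ) × (Fin k → V → ℝ) =>
        noisySum G ε (k + 1) T χ w (Fin.cons p.1 p.2)) ((noiseVec V).prod (noiseLaw V k)) :=
      hmp.integrable_comp_of_integrable hint
    rw [← hmp.map_eq, integral_map hmp.aemeasurable (by rw [hmp.map_eq]; exact hint.1),
      integral_prod _ hint']
    simp only [noisySum, Fin.cons_zero, Fin.cons_succ]
    simp only [ih T.tail _ _ fun ℓ i => hχ ℓ.succ i, homSum_tail_eq]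
    have hz : ∀ i, Integrable (fun z : V → ℝ => z i) (noiseVec V) :=
      integrable_noiseVec_comp integrable_id_laplaceStd
    have h0 : ∀ i, ∫ z : V → ℝ, z i ∂noiseVec V = 0 := fun i => by
      rw [integral_noiseVec_comp (fun x => x) (by fun_prop), integral_id_laplaceStd]
    have hz' : ∀ i ∈ Finset.univ, Integrable (fun z : V → ℝ => χ T.firstParent.succ i *
        w T.firstParent.succ i * (‖w 0‖ / ε * z i) *
          homCoef G T.tail (fun ℓ i => χ ℓ.succ i * w ℓ.succ i) T.firstParent i) (noiseVec V) :=
      fun i _ => (((hz i).const_mul _).const_mul _).mul_const _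
    rw [integral_add (integrable_const _) (integrable_finsetSum _ hz'), integral_finsetSum _ hz']
    simp [integral_const_mul, integral_mul_const, h0]

end Unbiased

/-! ### Pattern counts as sets of maps -/

section Occurrences

variable {V : Type*} [Fintype V] {G : SimpleGraph V} {k : ℕ}

open Classical in
/-- The occurrences of the pattern. -/
def occurrences (G : SimpleGraph V) (T : PatternTree k) : Finset (Fin (k + 1) → V) :=
  Finset.univ.filter fun f => IsTreeHom G T f ∧ Function.Injective f

lemma mem_occurrences {T : PatternTree k} {f : Fin (k + 1) → V} :
    f ∈ occurrences G T ↔ IsTreeHom G T f ∧ Function.Injective f := by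
  simp [occurrences]

/-- Labelled copies of the pattern are occurrences. -/
def copyEquivOccurrences (G : SimpleGraph V) (T : PatternTree k) :
    SimpleGraph.Copy T.pattern G ≃ {f // f ∈ occurrences G T} where
  toFun φ := ⟨fun ℓ => φ.toHom ℓ, mem_occurrences.2 ⟨fun c => φ.toHom.map_adj (by
    rw [PatternTree.pattern, SimpleGraph.fromRel_adj]
    exact ⟨(T.lt_parent c).ne, Or.inl ⟨c, rfl, rfl⟩⟩), φ.injective⟩⟩
  invFun f := ⟨⟨f.1, fun {u v} huv => by
    rw [PatternTree.pattern, SimpleGraph.fromRel_adj] at huv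
    obtain ⟨-, ⟨c, rfl, rfl⟩ | ⟨c, rfl, rfl⟩⟩ := huv
    · exact (mem_occurrences.1 f.2).1 c
    · exact ((mem_occurrences.1 f.2).1 c).symm⟩, (mem_occurrences.1 f.2).2⟩
  left_inv _ := rfl
  right_inv _ := rfl

lemma patternCount_eq_card (T : PatternTree k) :
    T.patternCount G = (occurrences G T).card := by
  -- The cardinality is computed for every `Fintype` instance, so the particular one inside
  -- `labelledCopyCount` does not matter.
  have h : ∀ inst : Fintype (SimpleGraph.Copy T.pattern G),
      @Fintype.card _ inst = (occurrences G T).card := fun inst =>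
    (Fintype.card_congr (copyEquivOccurrences G T)).trans (Fintype.card_coe _)
  exact h _

end Occurrences

/-! ### Mean and variance over the random marks -/

section Marks

set_option linter.unusedSectionVars false

variable {V : Type*} [Fintype V] {G : SimpleGraph V} [DecidableRel G.Adj] {k : ℕ}

open Classical in
/-- The indicator that the marks on `f` are the vertices of the tree. -/
def marked (f : Fin (k + 1) → V) (r : V → Fin (k + 1)) : ℝ :=
  if ∀ ℓ, r (f ℓ) = ℓ then 1 else 0

lemma prod_markInd (f : Fin (k + 1) → V) (r : V → Fin (k + 1)) :
    ∏ ℓ, markInd r ℓ (f ℓ) = marked f r := by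
  classical
  unfold markInd marked
  rw [Finset.prod_ite_zero]
  simp

/-- If the marks fit `f`, then `r` is a left inverse of `f`. Non-injective homomorphisms therefore
contribute nothing. -/
lemma homSum_markInd (T : PatternTree k) (r : V → Fin (k + 1)) :
    homSum G k T (markInd r) = ∑ f ∈ occurrences G T, marked f r := by
  classical
  rw [homSum_eq_sum, occurrences, Finset.sum_filter]
  refine Finset.sum_congr rfl fun f _ => ?_
  rw [prod_markInd]
  by_cases hf : Function.Injective f
  · simp [hf]
  · have : marked f r = 0 := by
      rw [marked, if_neg]
      intro h
      exact hf (Function.LeftInverse.injective h)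
    simp [hf, this]

/-- Leaves start with `1` at every node, but each count is used only after multiplication with its
mark indicator. The two conventions for the initial value thus become equal. -/
lemma markInd_mul_initCount (T : PatternTree k) (r : V → Fin (k + 1)) :
    (fun ℓ i => markInd r ℓ i * initCount T r ℓ i) = markInd r := by
  ext ℓ i
  unfold initCount markInd
  split_ifs <;> simp

lemma markLaw_real_forall_mem (U : Finset V) (h : V → Fin (k + 1)) :
    (markLaw V k).real {r | ∀ v ∈ U, r v = h v} = (((k : ℝ) + 1) ^ U.card)⁻¹ := by
  classical
  have hset : {r : V → Fin (k + 1) | ∀ v ∈ U, r v = h v} =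
      Set.pi Set.univ fun v => if v ∈ U then {h v} else Set.univ := by
    ext r
    simp only [Set.mem_ofPred_eq, Set.mem_pi, Set.mem_univ, true_imp_iff]
    refine forall_congr' fun v => ?_
    split_ifs with hv <;> simp [hv]
  have hv : ∀ v, (PMF.uniformOfFintype (Fin (k + 1))).toMeasure
      (if v ∈ U then {h v} else Set.univ) = if v ∈ U then ((k : ENNReal) + 1)⁻¹ else 1 := by
    intro v
    split_ifs
    · rw [PMF.toMeasure_apply_singleton _ _ (MeasurableSet.singleton _)]
      simp
    · exact measure_univ
  rw [Measure.real, hset, markLaw, Measure.pi_pi]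
  simp only [hv]
  rw [Finset.prod_ite_mem, Finset.univ_inter, Finset.prod_const]
  have : (((k : ENNReal) + 1)⁻¹).toReal = ((k : ℝ) + 1)⁻¹ := by
    rw [ENNReal.toReal_inv]
    congr 1
  rw [ENNReal.toReal_pow, this, inv_pow]

lemma integral_marked {f : Fin (k + 1) → V} (hf : Function.Injective f) :
    ∫ r, marked f r ∂markLaw V k = (((k : ℝ) + 1) ^ (k + 1))⁻¹ := by
  classical
  -- The prescribed marks invert `f` on its image; the default value `0` outside the image is never
  -- tested.
  have hset : (fun r => marked f r) = Set.indicator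
      {r | ∀ v ∈ Finset.univ.image f, r v = Function.extend f id 0 v} fun _ => (1 : ℝ) := by
    ext r
    rw [marked, Set.indicator_apply]
    refine if_congr ?_ rfl rfl
    simp [hf.extend_apply]
  have hcard : (Finset.univ.image f).card = k + 1 := by
    rw [Finset.card_image_of_injective _ hf, Finset.card_univ, Fintype.card_fin]
  rw [hset, integral_indicator_const _ (Set.toFinite _).measurableSet, markLaw_real_forall_mem,
    hcard, smul_eq_mul, mul_one]

/-- Two occurrences that agree on `m` tree vertices and are marked simultaneously with positive
probability have `2 (k + 1) - m` nodes. -/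
lemma integral_marked_mul_le {f g : Fin (k + 1) → V} (hf : Function.Injective f)
    (hg : Function.Injective g) :
    (((k : ℝ) + 1) ^ (k + 1)) ^ 2 * ∫ r, marked f r * marked g r ∂markLaw V k ≤
      open Classical in ∏ ℓ, if g ℓ = f ℓ then (k : ℝ) + 1 else 1 := by
  classical
  have hk1 : (0 : ℝ) < (k : ℝ) + 1 := by positivity
  set S : Finset (Fin (k + 1)) := Finset.univ.filter fun ℓ => g ℓ = f ℓ
  have hS : ∏ ℓ, (if g ℓ = f ℓ then (k : ℝ) + 1 else 1) = ((k : ℝ) + 1) ^ S.card := by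
    rw [← Finset.prod_filter, Finset.prod_const]
  rw [hS]
  by_cases hE : ∃ r₀ : V → Fin (k + 1), (∀ ℓ, r₀ (f ℓ) = ℓ) ∧ ∀ ℓ, r₀ (g ℓ) = ℓ
  · obtain ⟨r₀, h1, h2⟩ := hE
    set U := Finset.univ.image f ∪ Finset.univ.image g
    have hset : (fun r => marked f r * marked g r) = Set.indicator
        {r | ∀ v ∈ U, r v = r₀ v} fun _ => (1 : ℝ) := by
      ext r
      rw [marked, marked, ite_zero_mul_ite_zero, mul_one, Set.indicator_apply]
      refine if_congr ?_ rfl rfl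
      simp only [U, Set.mem_ofPred_eq, Finset.mem_union, Finset.mem_image, Finset.mem_univ,
        true_and, or_imp, forall_and, forall_exists_index, forall_apply_eq_imp_iff, h1, h2]
    -- A common node has a single mark under `r₀`, hence plays the same role in both occurrences.
    have hint : Finset.univ.image f ∩ Finset.univ.image g = S.image f := by
      ext v
      simp only [Finset.mem_inter, Finset.mem_image, Finset.mem_univ, true_and, S,
        Finset.mem_filter]
      constructor
      · rintro ⟨⟨ℓ, rfl⟩, m, hm⟩
        have : m = ℓ := by rw [← h2 m, hm, h1]
        subst this
        exact ⟨m, hm, rfl⟩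
      · rintro ⟨ℓ, h, rfl⟩
        exact ⟨⟨ℓ, rfl⟩, ℓ, h⟩
    have hcard : U.card + S.card = (k + 1) * 2 := by
      have := Finset.card_union_add_card_inter (Finset.univ.image f) (Finset.univ.image g)
      simp only [hint, Finset.card_image_of_injective _ hf, Finset.card_image_of_injective _ hg,
        Finset.card_univ, Fintype.card_fin] at this
      change (Finset.univ.image f ∪ Finset.univ.image g).card + _ = _
      omega
    rw [hset, integral_indicator_const _ (Set.toFinite _).measurableSet, markLaw_real_forall_mem,
      smul_eq_mul, mul_one, ← pow_mul, ← hcard, pow_add]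
    refine le_of_eq ?_
    field_simp
  · have hset : (fun r => marked f r * marked g r) = fun _ => 0 := by
      ext r
      rw [marked, marked, ite_zero_mul_ite_zero, if_neg fun h => hE ⟨r, h⟩]
    rw [hset]
    simp only [integral_zero, mul_zero]
    positivity

theorem integral_homSum_markInd (T : PatternTree k) :
    ((k : ℝ) + 1) ^ (k + 1) * ∫ r, homSum G k T (markInd r) ∂markLaw V k = T.patternCount G := by
  simp only [homSum_markInd]
  rw [integral_finsetSum _ fun _ _ => Integrable.of_finite, patternCount_eq_card,
    Finset.sum_congr rfl fun f hf => integral_marked (mem_occurrences.1 hf).2, Finset.sum_const,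
    nsmul_eq_mul]
  field_simp

lemma card_occurrences_le (T : PatternTree k) {d : ℕ} (hd : ∀ i, G.degree i ≤ d) :
    ((occurrences G T).card : ℝ) ≤ Fintype.card V * (d : ℝ) ^ k := by
  classical
  have h := homSum_le_prod (G := G) T (fun _ _ => 1)
    (Function.update (fun _ => (d : ℝ)) 0 (Fintype.card V)) 0 (fun _ _ => zero_le_one)
    (fun ℓ => by by_cases h : ℓ = 0 <;> simp [h]) (by simp)
    (fun ℓ hℓ i => by simpa [hℓ] using hd i)
  rw [Finset.prod_update_of_mem (Finset.mem_univ _), Finset.prod_const, homSum_eq_sum] at h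
  simp only [Finset.prod_const_one, ← Finset.sum_filter, Finset.sum_const, nsmul_one] at h
  refine le_trans ?_ (h.trans (le_of_eq ?_))
  · exact_mod_cast Finset.card_le_card fun f hf =>
      Finset.mem_filter.2 ⟨Finset.mem_univ _, (mem_occurrences.1 hf).1⟩
  · rw [← Finset.erase_eq, Finset.card_erase_of_mem (Finset.mem_univ _), Finset.card_univ,
      Fintype.card_fin, Nat.add_sub_cancel]

open Classical in
-- The summand vanishes unless `g` agrees with `f` at some `s`, and it is charged to every such `s`.
-- With `u_s` pinned to `f s`, extending along an edge costs at most `d + k`: there are `d`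
-- neighbours, one of which may have weight `k + 1` instead of `1`. One factor `k + 1` is the weight
-- of the pinned vertex, the other comes from the choice of `s`.
lemma sum_overlap_le (T : PatternTree k) {d : ℕ} (hd : ∀ i, G.degree i ≤ d)
    (f : Fin (k + 1) → V) :
    ∑ g ∈ occurrences G T, ((∏ ℓ, if g ℓ = f ℓ then (k : ℝ) + 1 else 1) - 1) ≤
      ((k : ℝ) + 1) ^ 2 * ((d : ℝ) + k + 1) ^ k := by
  have hk1 : (0 : ℝ) ≤ (k : ℝ) + 1 := by positivity
  set a : Fin (k + 1) → V → ℝ := fun ℓ v => if v = f ℓ then (k : ℝ) + 1 else 1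
  have ha : ∀ ℓ v, 0 ≤ a ℓ v := fun ℓ v => by
    simp only [a]; split_ifs <;> positivity
  have h1 : ∀ s, homSum G k T (Function.update a s (Pi.single (f s) ((k : ℝ) + 1))) ≤
      ((k : ℝ) + 1) * ((d : ℝ) + k + 1) ^ k := by
    intro s
    have h := homSum_le_prod (G := G) T (Function.update a s (Pi.single (f s) ((k : ℝ) + 1)))
      (Function.update (fun _ => (d : ℝ) + k + 1) s ((k : ℝ) + 1)) s (fun ℓ i => ?_)
      (fun ℓ => ?_) ?_ fun ℓ hℓ i => ?_
    · rwa [Finset.prod_update_of_mem (Finset.mem_univ _), Finset.prod_const,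
        ← Finset.erase_eq, Finset.card_erase_of_mem (Finset.mem_univ _), Finset.card_univ,
        Fintype.card_fin, Nat.add_sub_cancel] at h
    · by_cases h : ℓ = s
      · subst h
        by_cases hi : i = f ℓ
        · subst hi; simpa using hk1
        · simp [hi]
      · simpa [h] using ha ℓ i
    · by_cases h : ℓ = s
      · subst h; simpa using hk1
      · simp only [Function.update_of_ne h]; positivity
    · simp
    · simp only [Function.update_of_ne hℓ, a]
      calc ∑ j ∈ G.neighborFinset i, (if j = f ℓ then (k : ℝ) + 1 else 1)
          = ∑ j ∈ G.neighborFinset i, ((if j = f ℓ then (k : ℝ) else 0) + 1) :=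
            Finset.sum_congr rfl fun j _ => by split_ifs <;> simp
        _ ≤ k + d := by
            rw [Finset.sum_add_distrib]
            refine add_le_add ?_ (by simpa using hd i)
            rw [Finset.sum_ite_eq']
            split_ifs
            · rfl
            · positivity
        _ ≤ d + k + 1 := by linarith
  have h2 : ∀ g : Fin (k + 1) → V, (∏ ℓ, if g ℓ = f ℓ then (k : ℝ) + 1 else 1) - 1 ≤
      ∑ s, if g s = f s then ∏ ℓ, a ℓ (g ℓ) else 0 := by
    intro g
    by_cases hg : ∃ s, g s = f s
    · obtain ⟨s, hs⟩ := hg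
      have h0 : ∀ s, 0 ≤ if g s = f s then ∏ ℓ, a ℓ (g ℓ) else 0 := fun s => by
        split_ifs
        · exact Finset.prod_nonneg fun ℓ _ => ha _ _
        · rfl
      refine le_trans ?_ (Finset.single_le_sum (fun s _ => h0 s) (Finset.mem_univ s))
      rw [if_pos hs]
      simp [a]
    · push Not at hg
      simp [hg]
  have h3 : ∀ s, ∑ g ∈ occurrences G T, (if g s = f s then ∏ ℓ, a ℓ (g ℓ) else 0) ≤
      homSum G k T (Function.update a s (Pi.single (f s) ((k : ℝ) + 1))) := by
    intro s
    rw [homSum_update_eq_sum, occurrences, Finset.sum_filter]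
    refine Finset.sum_le_sum fun g _ => ?_
    have hnn : 0 ≤ ∏ ℓ ∈ Finset.univ \ {s}, a ℓ (g ℓ) := Finset.prod_nonneg fun ℓ _ => ha _ _
    by_cases hT : IsTreeHom G T g
    · by_cases hgs : g s = f s
      · have : ∏ ℓ, a ℓ (g ℓ) = ((k : ℝ) + 1) * ∏ ℓ ∈ Finset.univ \ {s}, a ℓ (g ℓ) := by
          rw [← Finset.erase_eq, ← Finset.mul_prod_erase _ _ (Finset.mem_univ s)]
          simp [a, hgs]
        rw [this]
        simp only [hT, hgs, if_true, Pi.single_eq_same, true_and]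
        split_ifs
        · rfl
        · positivity
      · simp [hgs]
    · simp [hT]
  calc ∑ g ∈ occurrences G T, ((∏ ℓ, if g ℓ = f ℓ then (k : ℝ) + 1 else 1) - 1)
      ≤ ∑ g ∈ occurrences G T, ∑ s, (if g s = f s then ∏ ℓ, a ℓ (g ℓ) else 0) :=
        Finset.sum_le_sum fun g _ => h2 g
    _ = ∑ s, ∑ g ∈ occurrences G T, (if g s = f s then ∏ ℓ, a ℓ (g ℓ) else 0) :=
        Finset.sum_comm
    _ ≤ ∑ _s : Fin (k + 1), ((k : ℝ) + 1) * ((d : ℝ) + k + 1) ^ k :=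
        Finset.sum_le_sum fun s _ => (h3 s).trans (h1 s)
    _ = ((k : ℝ) + 1) ^ 2 * ((d : ℝ) + k + 1) ^ k := by
        rw [Finset.sum_const, Finset.card_univ, Fintype.card_fin, nsmul_eq_mul]
        push_cast
        ring

/-- The variance of the rescaled number of marked occurrences. -/
theorem integral_sq_homSum_markInd_le (T : PatternTree k) {d : ℕ} (hd : ∀ i, G.degree i ≤ d) :
    ∫ r, (((k : ℝ) + 1) ^ (k + 1) * homSum G k T (markInd r) - T.patternCount G) ^ 2
        ∂markLaw V k ≤
      ((k : ℝ) + 1) ^ 2 * Fintype.card V * (((d : ℝ) + k + 1) ^ k) ^ 2 := by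
  classical
  set R : ℝ := ((k : ℝ) + 1) ^ (k + 1)
  have hR : R ≠ 0 := by positivity
  have hexp : ∀ r : V → Fin (k + 1), (R * homSum G k T (markInd r) - T.patternCount G) ^ 2 =
      ∑ f ∈ occurrences G T, ∑ g ∈ occurrences G T,
        (R ^ 2 * (marked f r * marked g r) - R * marked f r - R * marked g r + 1) := by
    intro r
    have h : R * homSum G k T (markInd r) - T.patternCount G =
        ∑ f ∈ occurrences G T, (R * marked f r - 1) := by
      rw [homSum_markInd, patternCount_eq_card, Finset.sum_sub_distrib, Finset.mul_sum]
      simp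
    rw [h, sq, Finset.sum_mul_sum]
    exact Finset.sum_congr rfl fun f _ => Finset.sum_congr rfl fun g _ => by ring
  have hI : ∀ f ∈ occurrences G T, ∫ r, marked f r ∂markLaw V k = R⁻¹ := fun f hf =>
    integral_marked (mem_occurrences.1 hf).2
  -- The integral is a sum of covariances of the rescaled indicators `R * marked`, each of which has
  -- mean `1`.
  have hle : ∫ r, (R * homSum G k T (markInd r) - T.patternCount G) ^ 2 ∂markLaw V k ≤
      ∑ f ∈ occurrences G T, ∑ g ∈ occurrences G T,
        ((∏ ℓ, if g ℓ = f ℓ then (k : ℝ) + 1 else 1) - 1) := by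
    simp only [hexp]
    rw [integral_finsetSum _ fun _ _ => Integrable.of_finite]
    refine Finset.sum_le_sum fun f hf => ?_
    rw [integral_finsetSum _ fun _ _ => Integrable.of_finite]
    refine Finset.sum_le_sum fun g hg => ?_
    rw [integral_add Integrable.of_finite Integrable.of_finite,
      integral_sub Integrable.of_finite Integrable.of_finite,
      integral_sub Integrable.of_finite Integrable.of_finite,
      integral_const_mul, integral_const_mul, integral_const_mul, hI f hf, hI g hg,
      mul_inv_cancel₀ hR]
    have := integral_marked_mul_le (mem_occurrences.1 hf).2 (mem_occurrences.1 hg).2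
    simp only [integral_const, probReal_univ, smul_eq_mul, mul_one]
    linarith
  refine hle.trans ((Finset.sum_le_sum fun f _ => sum_overlap_le T hd f).trans ?_)
  rw [Finset.sum_const, nsmul_eq_mul]
  have h1 := card_occurrences_le (G := G) T hd
  have h2 : (d : ℝ) ^ k ≤ ((d : ℝ) + k + 1) ^ k := by gcongr; linarith
  calc ((occurrences G T).card : ℝ) * (((k : ℝ) + 1) ^ 2 * ((d : ℝ) + k + 1) ^ k)
      ≤ (Fintype.card V * ((d : ℝ) + k + 1) ^ k) * (((k : ℝ) + 1) ^ 2 * ((d : ℝ) + k + 1) ^ k) := by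
        refine mul_le_mul_of_nonneg_right (h1.trans ?_) (by positivity)
        gcongr
    _ = _ := by ring

/-- Chebyshev's inequality for the rescaled number of marked occurrences. -/
theorem markLaw_real_deviation_le (T : PatternTree k) {d : ℕ} (hd : ∀ i, G.degree i ≤ d)
    {t : ℝ} (ht : 0 < t) :
    (markLaw V k).real {r | t <
        |((k : ℝ) + 1) ^ (k + 1) * homSum G k T (markInd r) - T.patternCount G|} ≤
      ((k : ℝ) + 1) ^ 2 * Fintype.card V * (((d : ℝ) + k + 1) ^ k) ^ 2 / t ^ 2 := by
  rw [le_div_iff₀ (by positivity), mul_comm]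
  refine le_trans ?_ (integral_sq_homSum_markInd_le T hd)
  refine le_trans ?_ (mul_meas_ge_le_integral_of_nonneg
    (Filter.Eventually.of_forall fun r => sq_nonneg _) Integrable.of_finite (t ^ 2))
  refine mul_le_mul_of_nonneg_left (measureReal_mono fun r hr => ?_) (by positivity)
  simp only [Set.mem_ofPred_eq] at hr ⊢
  rw [← sq_abs (_ - _)]
  gcongr

end Marks

lemma prod_real_le {α β : Type*} [MeasurableSpace α] [MeasurableSpace β] (μ : Measure α)
    (ν : Measure β) [IsProbabilityMeasure μ] [IsProbabilityMeasure ν] {S : Set (α × β)}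
    (hS : MeasurableSet S) {c : ℝ} (hc : 0 ≤ c) (h : ∀ x, ν.real (Prod.mk x ⁻¹' S) ≤ c) :
    (μ.prod ν).real S ≤ c := by
  rw [Measure.real, Measure.prod_apply hS]
  refine ENNReal.toReal_le_of_le_ofReal hc ?_
  calc ∫⁻ x, ν (Prod.mk x ⁻¹' S) ∂μ ≤ ∫⁻ _x, ENNReal.ofReal c ∂μ :=
        lintegral_mono fun x => (ENNReal.le_ofReal_iff_toReal_le (measure_ne_top _ _) hc).2 (h x)
    _ = ENNReal.ofReal c := by simp

/-! ### Propagation of the noise along the tree -/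

section Deviation

variable {V : Type*} [Fintype V] {G : SimpleGraph V} [DecidableRel G.Adj]

/-- Starting the count at `u_p`, pinned to `i`, each of the `k` remaining vertices `u_ℓ` contributes
a factor `M ℓ * B`. The factor `M p` on the left completes the product without a division. -/
lemma abs_homCoef_le {k : ℕ} (T : PatternTree k) (χ w : Fin (k + 1) → V → ℝ)
    (M : Fin (k + 1) → ℝ) {B : ℝ} (hB : 0 ≤ B) (hχ0 : ∀ ℓ i, 0 ≤ χ ℓ i)
    (hw : ∀ ℓ i, |w ℓ i| ≤ M ℓ) (hM : ∀ ℓ, 0 ≤ M ℓ)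
    (hn : ∀ ℓ i, ∑ j ∈ G.neighborFinset i, χ ℓ j ≤ B) (p : Fin (k + 1)) (i : V) :
    M p * |homCoef G T (fun ℓ i => χ ℓ i * w ℓ i) p i| ≤ (∏ ℓ, M ℓ) * B ^ k := by
  classical
  have h := homSum_le_prod (G := G) T
    (fun ℓ j => |Function.update (fun ℓ i => χ ℓ i * w ℓ i) p (Pi.single i 1) ℓ j|)
    (Function.update (fun ℓ => M ℓ * B) p 1) p (fun _ _ => abs_nonneg _) (fun ℓ => ?_) ?_
    fun ℓ hℓ j => ?_
  · refine (mul_le_mul_of_nonneg_left ((abs_homSum_le T _).trans h) (hM p)).trans (le_of_eq ?_)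
    rw [Finset.prod_update_of_mem (Finset.mem_univ _), one_mul, Finset.prod_mul_distrib,
      Finset.prod_const, ← Finset.erase_eq, ← mul_assoc,
      Finset.mul_prod_erase _ _ (Finset.mem_univ _), Finset.card_erase_of_mem (Finset.mem_univ _),
      Finset.card_univ, Fintype.card_fin, Nat.add_sub_cancel]
  · by_cases h : ℓ = p
    · subst h; simp
    · simpa [h] using mul_nonneg (hM ℓ) hB
  · simp only [Function.update_self]
    rw [Finset.sum_eq_single i]
    · simp
    · intro j _ hj; simp [hj]
    · simp
  · simp only [Function.update_of_ne hℓ]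
    calc ∑ m ∈ G.neighborFinset j, |χ ℓ m * w ℓ m|
        ≤ ∑ m ∈ G.neighborFinset j, M ℓ * χ ℓ m := Finset.sum_le_sum fun m _ => by
          rw [abs_mul, abs_of_nonneg (hχ0 _ _), mul_comm]
          exact mul_le_mul_of_nonneg_right (hw _ _) (hχ0 _ _)
      _ ≤ M ℓ * B := by
          rw [← Finset.mul_sum]
          exact mul_le_mul_of_nonneg_left (hn _ _) (hM _)

/-- The noise changes the count by a sum of `k` terms, one for each edge, each of which is a linear
form in the noise of this edge. -/
theorem noiseLaw_deviation_le {ε : ℝ} (hε : 0 < ε) {B t δ : ℝ} (hB : 0 ≤ B) (hδ : 0 ≤ δ)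
    (hdev : ∀ (b : V → ℝ) (A : ℝ), 0 ≤ A → (∀ i, |b i| ≤ A) →
      (noiseVec V).real {y | A * t < |∑ i, b i * y i|} ≤ δ)
    {k : ℕ} (T : PatternTree k) (χ w : Fin (k + 1) → V → ℝ) (M : Fin (k + 1) → ℝ)
    (hχ0 : ∀ ℓ i, 0 ≤ χ ℓ i) (hχ1 : ∀ ℓ i, χ ℓ i ≤ 1) (hw : ∀ ℓ i, |w ℓ i| ≤ M ℓ)
    (hM : ∀ ℓ, 0 ≤ M ℓ) (hn : ∀ ℓ i, ∑ j ∈ G.neighborFinset i, χ ℓ j ≤ B) :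
    (noiseLaw V k).real {z |
      (∀ c i, ∑ j ∈ G.neighborFinset i, χ (Fin.castSucc c) j + |z c i| / ε ≤ B) ∧
      k * ((∏ ℓ, M ℓ) * B ^ (k - 1) / ε * t) <
        |noisySum G ε k T χ w z - homSum G k T fun ℓ i => χ ℓ i * w ℓ i|} ≤ k * δ := by
  induction k with
  | zero => simp [noisySum, homSum]
  | succ k ih =>
    set p := T.firstParent with hp
    set P := (∏ ℓ, M ℓ) * B ^ k / ε * t with hP
    set w' : (V → ℝ) → Fin (k + 1) → V → ℝ := fun y =>
      Function.update (fun ℓ => w ℓ.succ) p fun i => w p.succ i *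
        (∑ j ∈ G.neighborFinset i, χ 0 j * w 0 j + ‖w 0‖ / ε * y i) with hw'
    set b : V → ℝ := fun i => χ p.succ i * w p.succ i * (‖w 0‖ / ε) *
      homCoef G T.tail (fun ℓ i => χ ℓ.succ i * w ℓ.succ i) p i with hb
    have hw0 : ‖w 0‖ ≤ M 0 := (pi_norm_le_iff_of_nonneg (hM 0)).2 fun i => hw 0 i
    have hMp : ∏ ℓ, M ℓ = M 0 * ∏ ℓ : Fin (k + 1), M ℓ.succ := Fin.prod_univ_succ M
    -- Replacing all later noise by zero leaves an affine function of the current noise `y`. The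
    -- event `D` controls its linear part, and the induction hypothesis controls the later noise
    -- through `E`.
    have hlin : ∀ y, homSum G k T.tail (fun ℓ i => χ ℓ.succ i * w' y ℓ i) =
        homSum G (k + 1) T (fun ℓ i => χ ℓ i * w ℓ i) + ∑ i, b i * y i := by
      intro y
      rw [hw', homSum_tail_eq]
      congr 1
      exact Finset.sum_congr rfl fun i _ => by rw [hb]; ring
    have hbA : ∀ i, |b i| ≤ (∏ ℓ, M ℓ) * B ^ k / ε := by
      intro i
      have h1 := abs_homCoef_le (G := G) T.tail (fun ℓ => χ ℓ.succ) (fun ℓ => w ℓ.succ)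
        (fun ℓ => M ℓ.succ) hB (fun ℓ => hχ0 _) (fun ℓ => hw _) (fun ℓ => hM _)
        (fun ℓ => hn _) p i
      have h2 : |χ p.succ i * w p.succ i| ≤ M p.succ := by
        rw [abs_mul, abs_of_nonneg (hχ0 _ _)]
        exact (mul_le_of_le_one_left (abs_nonneg _) (hχ1 _ _)).trans (hw _ _)
      calc |b i| = |χ p.succ i * w p.succ i| *
            |homCoef G T.tail (fun ℓ i => χ ℓ.succ i * w ℓ.succ i) p i| * (‖w 0‖ / ε) := by
            rw [hb]
            simp only [abs_mul, abs_div, abs_norm, abs_of_pos hε]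
            ring
        _ ≤ M p.succ * |homCoef G T.tail (fun ℓ i => χ ℓ.succ i * w ℓ.succ i) p i| *
            (M 0 / ε) := by
            have := hM p.succ
            gcongr
        _ ≤ ((∏ ℓ : Fin (k + 1), M ℓ.succ) * B ^ k) * (M 0 / ε) :=
            mul_le_mul_of_nonneg_right h1 (div_nonneg (hM 0) hε.le)
        _ = (∏ ℓ, M ℓ) * B ^ k / ε := by rw [hMp]; ring
    have hmp := measurePreserving_cons (V := V) k
    set D : Set ((V → ℝ) × (Fin k → V → ℝ)) := {q | P < |∑ i, b i * q.1 i|} with hD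
    set E : Set ((V → ℝ) × (Fin k → V → ℝ)) := {q |
      (∀ i, ∑ j ∈ G.neighborFinset i, χ 0 j + |q.1 i| / ε ≤ B) ∧
      (∀ c i, ∑ j ∈ G.neighborFinset i, χ (Fin.castSucc c).succ j + |q.2 c i| / ε ≤ B) ∧
      k * P < |noisySum G ε k T.tail (fun ℓ => χ ℓ.succ) (w' q.1) q.2 -
        (homSum G (k + 1) T (fun ℓ i => χ ℓ i * w ℓ i) + ∑ i, b i * q.1 i)|} with hE
    have hDm : MeasurableSet D := by
      refine (isOpen_lt continuous_const ?_).measurableSet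
      fun_prop
    have hw'c : Continuous fun q : (V → ℝ) × (Fin k → V → ℝ) => w' q.1 := by
      rw [hw']
      refine Continuous.update (by fun_prop) _ ?_
      fun_prop
    have hEm : MeasurableSet E := by
      refine MeasurableSet.inter ?_ (MeasurableSet.inter ?_ ?_)
      · have : IsClosed {q : (V → ℝ) × (Fin k → V → ℝ) |
            ∀ i, ∑ j ∈ G.neighborFinset i, χ 0 j + |q.1 i| / ε ≤ B} := by
          simp only [Set.ofPred_forall]
          exact isClosed_iInter fun i => isClosed_le (by fun_prop) continuous_const
        exact this.measurableSet
      · have : IsClosed {q : (V → ℝ) × (Fin k → V → ℝ) | ∀ c i,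
            ∑ j ∈ G.neighborFinset i, χ (Fin.castSucc c).succ j + |q.2 c i| / ε ≤ B} := by
          simp only [Set.ofPred_forall]
          exact isClosed_iInter fun c => isClosed_iInter fun i =>
            isClosed_le (by fun_prop) continuous_const
        exact this.measurableSet
      · have h := continuous_noisySum (G := G) ε T.tail (fun ℓ => χ ℓ.succ)
          (fun q : (V → ℝ) × (Fin k → V → ℝ) => w' q.1) (fun q => q.2) hw'c continuous_snd
        exact measurableSet_lt measurable_const
          (Continuous.abs (h.sub (by fun_prop))).measurable
    have hDle : ((noiseVec V).prod (noiseLaw V k)).real D ≤ δ := by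
      have : D = {y | P < |∑ i, b i * y i|} ×ˢ Set.univ := by ext q; simp [hD]
      rw [this, measureReal_prod_prod, probReal_univ, mul_one]
      exact hdev b _ (div_nonneg (mul_nonneg (Finset.prod_nonneg fun ℓ _ => hM ℓ)
        (pow_nonneg hB k)) hε.le) hbA
    have hEle : ((noiseVec V).prod (noiseLaw V k)).real E ≤ k * δ := by
      refine prod_real_le _ _ hEm (by positivity) fun y => ?_
      by_cases hy : ∀ i, ∑ j ∈ G.neighborFinset i, χ 0 j + |y i| / ε ≤ B
      · set M' : Fin (k + 1) → ℝ := Function.update (fun ℓ => M ℓ.succ) p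
          (M p.succ * (M 0 * B)) with hM'
        -- The new bound `M'` absorbs one factor `B`. For `k = 0` the exponent `k - 1` is truncated,
        -- but the leading factor `k` makes both sides zero.
        have hprod : k * ((∏ ℓ, M' ℓ) * B ^ (k - 1) / ε * t) = k * P := by
          rcases k.eq_zero_or_pos with rfl | hk
          · simp
          · have hBk : B ^ k = B * B ^ (k - 1) := (mul_pow_sub_one hk.ne' B).symm
            rw [hM', prod_update_mul, hP, hMp, hBk]
            ring
        refine le_trans (measureReal_mono fun z hz => ?_) (ih T.tail (fun ℓ => χ ℓ.succ) (w' y) M'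
          (fun ℓ => hχ0 _) (fun ℓ => hχ1 _) ?_ ?_ fun ℓ => hn _)
        · obtain ⟨-, h2, h3⟩ := hz
          refine ⟨h2, ?_⟩
          rw [hprod, hlin]
          exact h3
        · intro ℓ i
          by_cases h : ℓ = p
          · subst h
            simp only [hw', hM', Function.update_self, abs_mul]
            refine mul_le_mul (hw _ _) ?_ (abs_nonneg _) (hM _)
            refine le_trans ?_ (mul_le_mul_of_nonneg_left (hy i) (hM 0))
            rw [mul_add, Finset.mul_sum]
            refine (abs_add_le _ _).trans (add_le_add ((Finset.abs_sum_le_sum_abs _ _).trans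
              (Finset.sum_le_sum fun j _ => ?_)) ?_)
            · rw [abs_mul, abs_of_nonneg (hχ0 _ _), mul_comm]
              exact mul_le_mul_of_nonneg_right (hw _ _) (hχ0 _ _)
            · rw [abs_mul, abs_of_nonneg (by positivity), div_mul_eq_mul_div, mul_div_assoc]
              gcongr
          · simpa [hw', hM', h] using hw _ _
        · intro ℓ
          by_cases h : ℓ = p
          · subst h
            simpa [hM'] using mul_nonneg (hM _) (mul_nonneg (hM _) hB)
          · simpa [hM', h] using hM _
      · have : Prod.mk y ⁻¹' E = ∅ := by
          ext z
          simp only [Set.mem_preimage, Set.mem_empty_iff_false, iff_false]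
          exact fun h => hy h.1
        rw [this, measureReal_empty]
        positivity
    have hsub : (fun q : (V → ℝ) × (Fin k → V → ℝ) => (Fin.cons q.1 q.2 : Fin (k + 1) → V → ℝ)) ⁻¹'
        {z | (∀ c i, ∑ j ∈ G.neighborFinset i, χ (Fin.castSucc c) j + |z c i| / ε ≤ B) ∧
          (k + 1 : ℕ) * ((∏ ℓ, M ℓ) * B ^ (k + 1 - 1) / ε * t) < |noisySum G ε (k + 1) T χ w z -
            homSum G (k + 1) T fun ℓ i => χ ℓ i * w ℓ i|} ⊆ D ∪ E := by
      rintro q ⟨h1, h2⟩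
      rw [Set.mem_union, or_iff_not_imp_left]
      intro hq
      refine ⟨fun i => by simpa using h1 0 i, fun c i => by simpa using h1 c.succ i, ?_⟩
      have hq' : |∑ i, b i * q.1 i| ≤ P := not_lt.1 hq
      have hns : noisySum G ε (k + 1) T χ w (Fin.cons q.1 q.2) =
          noisySum G ε k T.tail (fun ℓ => χ ℓ.succ) (w' q.1) q.2 := by
        simp only [noisySum, Fin.cons_zero, Fin.cons_succ, hw', hp]
      rw [hns, Nat.add_sub_cancel, ← hP] at h2
      push_cast at h2
      have := abs_sub_abs_le_abs_sub (noisySum G ε k T.tail (fun ℓ => χ ℓ.succ) (w' q.1) q.2 -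
        homSum G (k + 1) T fun ℓ i => χ ℓ i * w ℓ i) (∑ i, b i * q.1 i)
      rw [sub_sub] at this
      linarith
    have hle : ((noiseVec V).prod (noiseLaw V k)).real (D ∪ E) ≤ (k + 1 : ℕ) * δ := by
      refine (measureReal_union_le _ _).trans ?_
      push_cast
      linarith
    refine le_trans ?_ hle
    refine le_trans (le_of_eq ?_) (measureReal_mono hsub)
    refine (hmp.measureReal_preimage (MeasurableSet.nullMeasurableSet ?_)).symm
    refine MeasurableSet.inter ?_ ?_
    · have : IsClosed {z : Fin (k + 1) → V → ℝ | ∀ c i,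
          ∑ j ∈ G.neighborFinset i, χ (Fin.castSucc c) j + |z c i| / ε ≤ B} := by
        simp only [Set.ofPred_forall]
        exact isClosed_iInter fun c => isClosed_iInter fun i =>
          isClosed_le (by fun_prop) continuous_const
      exact this.measurableSet
    · have h := continuous_noisySum (G := G) ε T χ (fun _ : Fin (k + 1) → V → ℝ => w) id
        continuous_const continuous_id
      exact measurableSet_lt measurable_const (Continuous.abs (h.sub continuous_const)).measurable

end Deviation

/-! ### Chernoff bounds for noise and marks -/

section Tails

open Real

variable {V : Type*} [Fintype V]

lemma real_lt_le_exp_mul_integral {Ω : Type*} [MeasurableSpace Ω] (μ : Measure Ω)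
    [IsFiniteMeasure μ] (X : Ω → ℝ) (t : ℝ) {s : ℝ} (hs : 0 ≤ s)
    (hX : Integrable (fun ω => exp (s * X ω)) μ) :
    μ.real {ω | t < X ω} ≤ exp (-(s * t)) * ∫ ω, exp (s * X ω) ∂μ := by
  have h := mul_meas_ge_le_integral_of_nonneg
    (Filter.Eventually.of_forall fun ω => (exp_pos (s * X ω)).le) hX (exp (s * t))
  rw [exp_neg, ← div_eq_inv_mul, le_div_iff₀ (exp_pos _), mul_comm]
  refine le_trans (mul_le_mul_of_nonneg_left (measureReal_mono fun ω hω => ?_) (exp_pos _).le) h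
  exact exp_le_exp.2 (mul_le_mul_of_nonneg_left (le_of_lt hω) hs)

lemma noiseVec_real_lt_sum_le {b : V → ℝ} (hb : ∀ i, |b i| ≤ 1) (t : ℝ) {s : ℝ} (hs : 0 ≤ s)
    (hs2 : s ^ 2 ≤ 1 / 2) :
    (noiseVec V).real {y | t < ∑ i, b i * y i} ≤
      exp (-(s * t) + 2 * s ^ 2 * Fintype.card V) := by
  have hsb : ∀ i, (s * b i) ^ 2 ≤ s ^ 2 := fun i => by
    rw [mul_pow]
    exact mul_le_of_le_one_right (sq_nonneg _) ((sq_le_one_iff_abs_le_one _).2 (hb i))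
  have hlt : ∀ i, |s * b i| < 1 := fun i =>
    (sq_lt_one_iff_abs_lt_one _).1 (by linarith [hsb i])
  have hexp : (fun y : V → ℝ => exp (s * ∑ i, b i * y i)) =
      fun y => ∏ i, (fun i x => exp (s * b i * x)) i (y i) := by
    ext y
    rw [← exp_sum, Finset.mul_sum]
    simp only [mul_assoc]
  have hint : Integrable (fun y : V → ℝ => exp (s * ∑ i, b i * y i)) (noiseVec V) := by
    rw [hexp]
    exact Integrable.fintype_prod fun i => integrable_exp_laplaceStd (hlt i)
  refine (real_lt_le_exp_mul_integral _ _ t hs hint).trans ?_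
  rw [exp_add]
  refine mul_le_mul_of_nonneg_left ?_ (exp_pos _).le
  rw [hexp, noiseVec, integral_fintype_prod_eq_prod (fun i x => exp (s * b i * x))]
  calc ∏ i, ∫ x, exp (s * b i * x) ∂laplaceStd ≤ ∏ _i : V, exp (2 * s ^ 2) := by
        refine Finset.prod_le_prod (fun i _ => integral_nonneg fun x => (exp_pos _).le)
          fun i _ => ?_
        refine (integral_exp_laplaceStd_le ((hsb i).trans hs2)).trans (exp_le_exp.2 ?_)
        linarith [hsb i]
    _ = exp (2 * s ^ 2 * Fintype.card V) := by
        rw [Finset.prod_const, ← exp_nat_mul, Finset.card_univ, mul_comm]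

lemma noiseVec_real_lt_abs_sum_le {b : V → ℝ} {A : ℝ} (hA : 0 ≤ A) (hb : ∀ i, |b i| ≤ A) (t : ℝ)
    {s : ℝ} (hs : 0 ≤ s) (hs2 : s ^ 2 ≤ 1 / 2) :
    (noiseVec V).real {y | A * t < |∑ i, b i * y i|} ≤
      2 * exp (-(s * t) + 2 * s ^ 2 * Fintype.card V) := by
  rcases hA.eq_or_lt with rfl | hA
  · have hb0 : ∀ i, b i = 0 := fun i => abs_nonpos_iff.1 (hb i)
    simp only [hb0, zero_mul, Finset.sum_const_zero, abs_zero, lt_self_iff_false]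
    rw [Set.ofPred_false, measureReal_empty]
    positivity
  · have h1 : ∀ i, |b i / A| ≤ 1 := fun i => by
      rw [abs_div, abs_of_pos hA, div_le_one hA]; exact hb i
    have h2 : ∀ i, |-(b i / A)| ≤ 1 := fun i => by rw [abs_neg]; exact h1 i
    have hsub : {y : V → ℝ | A * t < |∑ i, b i * y i|} ⊆
        {y | t < ∑ i, b i / A * y i} ∪ {y | t < ∑ i, -(b i / A) * y i} := by
      intro y hy
      have h3 : ∑ i, b i / A * y i = (∑ i, b i * y i) / A := by
        rw [Finset.sum_div]; exact Finset.sum_congr rfl fun i _ => by ring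
      simp only [Set.mem_union, Set.mem_ofPred_eq, neg_mul, Finset.sum_neg_distrib, h3] at hy ⊢
      rw [lt_div_iff₀ hA, ← neg_div, lt_div_iff₀ hA, mul_comm]
      exact lt_abs.1 hy
    refine (measureReal_mono hsub).trans ((measureReal_union_le _ _).trans ?_)
    rw [two_mul]
    exact add_le_add (noiseVec_real_lt_sum_le h1 t hs hs2) (noiseVec_real_lt_sum_le h2 t hs hs2)

lemma laplaceStd_real_lt_abs {L : ℝ} (hL : 0 ≤ L) : laplaceStd.real {x | L < |x|} = exp (-L) := by
  have hm : MeasurableSet {x : ℝ | L < |x|} := measurableSet_lt measurable_const (by fun_prop)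
  have h1 : laplaceStd.real {x | L < |x|} =
      ∫ x, {x : ℝ | L < |x|}.indicator (fun _ => (1 : ℝ)) x ∂laplaceStd := by
    rw [integral_indicator_const _ hm, smul_eq_mul, mul_one]
  have h2 : (fun x : ℝ => exp (-|x|) / 2 * {x : ℝ | L < |x|}.indicator (fun _ => (1 : ℝ)) x) =
      fun x => (Set.Ioi L).indicator (fun y => exp (-1 * y) / 2) |x| := by
    ext x
    by_cases h : L < |x|
    · simp [h]
    · simp [h]
  rw [h1, integral_laplaceStd, h2,
    integral_comp_abs (f := (Set.Ioi L).indicator fun y => exp (-1 * y) / 2),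
    setIntegral_indicator measurableSet_Ioi,
    Set.inter_eq_right.2 (Set.Ioi_subset_Ioi hL), integral_div,
    integral_exp_mul_Ioi (by norm_num)]
  simp
  ring

variable {k : ℕ}

lemma integral_exp_markInd (s : ℝ) (ℓ : Fin (k + 1)) :
    ∫ x, exp (s * if x = ℓ then 1 else 0) ∂(PMF.uniformOfFintype (Fin (k + 1))).toMeasure ≤
      exp ((exp s - 1) / ((k : ℝ) + 1)) := by
  have hk : (0 : ℝ) < (k : ℝ) + 1 := by positivity
  have h1 : ∀ x : Fin (k + 1), exp (s * if x = ℓ then 1 else 0) =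
      1 + if x = ℓ then exp s - 1 else 0 := fun x => by split_ifs <;> simp
  have h2 : ∀ x, ((PMF.uniformOfFintype (Fin (k + 1))) x).toReal = ((k : ℝ) + 1)⁻¹ := fun x => by
    rw [PMF.uniformOfFintype_apply, Fintype.card_fin, ENNReal.toReal_inv, ENNReal.toReal_natCast]
    push_cast
    rfl
  rw [PMF.integral_eq_sum]
  simp only [h1, h2, smul_eq_mul, ← Finset.mul_sum, Finset.sum_add_distrib, Finset.sum_ite_eq',
    Finset.mem_univ, if_true, Finset.sum_const, Finset.card_univ, Fintype.card_fin, nsmul_one]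
  refine le_trans (le_of_eq ?_) (add_one_le_exp _)
  push_cast
  field_simp
  ring

/-- The marks are independent, and each factor is `1 + (exp s - 1)/(k+1)`. Only an upper bound `d`
on the size of `S` is used, so `d̂` may replace the true degree. -/
lemma integral_exp_sum_markInd_le {s : ℝ} (hs : 0 ≤ s) (S : Finset V) {d : ℝ} (hd : S.card ≤ d)
    (ℓ : Fin (k + 1)) :
    ∫ r, exp (s * ∑ j ∈ S, markInd r ℓ j) ∂markLaw V k ≤ exp (d / (k + 1) * (exp s - 1)) := by
  classical
  have hexp : (fun r : V → Fin (k + 1) => exp (s * ∑ j ∈ S, markInd r ℓ j)) =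
      fun r => ∏ j, (fun (j : V) (x : Fin (k + 1)) =>
        if j ∈ S then exp (s * if x = ℓ then 1 else 0) else 1) j (r j) := by
    ext r
    rw [Finset.prod_ite_mem, Finset.univ_inter, ← exp_sum, Finset.mul_sum]
    rfl
  rw [hexp, markLaw, integral_fintype_prod_eq_prod (fun (j : V) (x : Fin (k + 1)) =>
        if j ∈ S then exp (s * if x = ℓ then 1 else 0) else 1)]
  have h0 : 0 ≤ (exp s - 1) / ((k : ℝ) + 1) :=
    div_nonneg (by linarith [add_one_le_exp s]) (by positivity)
  calc ∏ j, ∫ x, (if j ∈ S then exp (s * if x = ℓ then 1 else 0) else 1)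
          ∂(PMF.uniformOfFintype (Fin (k + 1))).toMeasure
      ≤ ∏ j, if j ∈ S then exp ((exp s - 1) / ((k : ℝ) + 1)) else 1 := by
        refine Finset.prod_le_prod (fun j _ => integral_nonneg fun x => ?_) fun j _ => ?_
        · dsimp only; split_ifs <;> positivity
        · split_ifs
          · exact integral_exp_markInd s ℓ
          · simp
    _ = exp (S.card * ((exp s - 1) / ((k : ℝ) + 1))) := by
        rw [Finset.prod_ite_mem, Finset.univ_inter, Finset.prod_const, exp_nat_mul]
    _ ≤ exp (d / (k + 1) * (exp s - 1)) := by
        refine exp_le_exp.2 ((mul_le_mul_of_nonneg_right hd h0).trans (le_of_eq ?_))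
        ring

/-- Chernoff's bound for the number of nodes with a given mark in a set of nodes. -/
lemma markLaw_real_lt_sum_le {s : ℝ} (hs : 0 ≤ s) (S : Finset V) {d : ℝ} (hd : S.card ≤ d)
    (ℓ : Fin (k + 1)) (B : ℝ) :
    (markLaw V k).real {r | B < ∑ j ∈ S, markInd r ℓ j} ≤
      exp (-(s * B) + d / (k + 1) * (exp s - 1)) := by
  rw [exp_add]
  exact (real_lt_le_exp_mul_integral _ _ B hs Integrable.of_finite).trans
    (mul_le_mul_of_nonneg_left (integral_exp_sum_markInd_le hs S hd ℓ) (exp_pos _).le)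

lemma measurePreserving_noise_eval (c : Fin k) (i : V) :
    MeasurePreserving (fun z : Fin k → V → ℝ => z c i) (noiseLaw V k) laplaceStd :=
  (measurePreserving_eval (fun _ : V => laplaceStd) i).comp
    (measurePreserving_eval (fun _ : Fin k => noiseVec V) c)

lemma noiseLaw_real_lt_abs {L : ℝ} (hL : 0 ≤ L) (c : Fin k) (i : V) :
    (noiseLaw V k).real {z | L < |z c i|} = exp (-L) := by
  have hm : MeasurableSet {x : ℝ | L < |x|} := measurableSet_lt measurable_const (by fun_prop)
  rw [← laplaceStd_real_lt_abs hL]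
  exact (measurePreserving_noise_eval c i).measureReal_preimage hm.nullMeasurableSet

/-- Chernoff's bound for the sum of the number of nodes with a given mark and the size of the
noise. -/
lemma prod_real_lt_sum_add_le {ε s : ℝ} (hs : 0 ≤ s) (hsε : s / ε ≤ 1 / 2)
    (S : Finset V) {d : ℝ} (hd : S.card ≤ d) (ℓ : Fin (k + 1)) (c : Fin k) (i : V) (B : ℝ) :
    ((markLaw V k).prod (noiseLaw V k)).real
        {q | B < ∑ j ∈ S, markInd q.1 ℓ j + |q.2 c i| / ε} ≤
      2 * exp (-(s * B) + d / (k + 1) * (exp s - 1)) := by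
  have hexp : (fun q : (V → Fin (k + 1)) × (Fin k → V → ℝ) =>
      exp (s * (∑ j ∈ S, markInd q.1 ℓ j + |q.2 c i| / ε))) =
      fun q => exp (s * ∑ j ∈ S, markInd q.1 ℓ j) * exp (s / ε * |q.2 c i|) := by
    ext q
    rw [← exp_add]
    ring_nf
  have hmp := measurePreserving_noise_eval (V := V) c i
  have hZ : Integrable (fun z : Fin k → V → ℝ => exp (s / ε * |z c i|)) (noiseLaw V k) :=
    hmp.integrable_comp_of_integrable (integrable_exp_abs_laplaceStd (s := s / ε) (by linarith))
  -- The exponential moment is `1 / (1 - s/ε)`, and `s/ε ≤ 1/2` makes it at most `2`.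
  have hZle : ∫ z : Fin k → V → ℝ, exp (s / ε * |z c i|) ∂noiseLaw V k ≤ 2 := by
    have h := integral_map (φ := fun z : Fin k → V → ℝ => z c i) (μ := noiseLaw V k)
      hmp.aemeasurable (f := fun x => exp (s / ε * |x|)) (by fun_prop)
    rw [hmp.map_eq, integral_exp_abs_laplaceStd (by linarith)] at h
    rw [← h, div_le_iff₀ (by linarith)]
    linarith
  have hint : Integrable (fun q : (V → Fin (k + 1)) × (Fin k → V → ℝ) =>
      exp (s * (∑ j ∈ S, markInd q.1 ℓ j + |q.2 c i| / ε)))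
      ((markLaw V k).prod (noiseLaw V k)) := by
    rw [hexp]
    exact Integrable.mul_prod (f := fun r => exp (s * ∑ j ∈ S, markInd r ℓ j))
      Integrable.of_finite hZ
  refine (real_lt_le_exp_mul_integral _ _ B hs hint).trans ?_
  rw [hexp, integral_prod_mul (fun r => exp (s * ∑ j ∈ S, markInd r ℓ j))
    fun z : Fin k → V → ℝ => exp (s / ε * |z c i|), exp_add, mul_left_comm (2 : ℝ)]
  refine mul_le_mul_of_nonneg_left ?_ (exp_pos _).le
  rw [mul_comm]
  exact mul_le_mul hZle (integral_exp_sum_markInd_le hs S hd ℓ)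
    (integral_nonneg fun r => (exp_pos _).le) zero_le_two

end Tails

/-! ### Combining marks and noise -/

section Combination

set_option linter.unusedSectionVars false

variable {V : Type*} [Fintype V] (G : SimpleGraph V) [DecidableRel G.Adj] {k : ℕ}

/-- The marks and the noise are so small that no noisy message is large. -/
def IsGood (ε B : ℝ) (q : (V → Fin (k + 1)) × (Fin k → V → ℝ)) : Prop :=
  (∀ ℓ i, ∑ j ∈ G.neighborFinset i, markInd q.1 ℓ j ≤ B) ∧
    ∀ c i, ∑ j ∈ G.neighborFinset i, markInd q.1 (Fin.castSucc c) j + |q.2 c i| / ε ≤ B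

/-- The output of the mechanism as a function of the marks and the noise. -/
def outputFun (T : PatternTree k) (ε : ℝ) (q : (V → Fin (k + 1)) × (Fin k → V → ℝ)) : ℝ :=
  ((k : ℝ) + 1) ^ (k + 1) * noisySum G ε k T (markInd q.1) (initCount T q.1) q.2

variable {G}

lemma markInd_nonneg (r : V → Fin (k + 1)) (ℓ : Fin (k + 1)) (i : V) : 0 ≤ markInd r ℓ i := by
  unfold markInd; split_ifs <;> simp

lemma markInd_le_one (r : V → Fin (k + 1)) (ℓ : Fin (k + 1)) (i : V) : markInd r ℓ i ≤ 1 := by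
  unfold markInd; split_ifs <;> simp

lemma abs_markInd_le_one (r : V → Fin (k + 1)) (ℓ : Fin (k + 1)) (i : V) :
    |markInd r ℓ i| ≤ 1 := by
  rw [abs_of_nonneg (markInd_nonneg _ _ _)]; exact markInd_le_one _ _ _

lemma abs_initCount_le_one (T : PatternTree k) (r : V → Fin (k + 1)) (ℓ : Fin (k + 1)) (i : V) :
    |initCount T r ℓ i| ≤ 1 := by
  unfold initCount
  split_ifs
  · simp
  · exact abs_markInd_le_one _ _ _

/-- There are only finitely many markings, so measurability can be checked for fixed marks, where
the output is continuous in the noise. -/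
lemma measurable_noisySum (T : PatternTree k) (ε : ℝ) :
    Measurable fun q : (V → Fin (k + 1)) × (Fin k → V → ℝ) =>
      noisySum G ε k T (markInd q.1) (initCount T q.1) q.2 :=
  measurable_from_prod_countable_right fun r =>
    (continuous_noisySum ε T (markInd r) (fun _ : Fin k → V → ℝ => initCount T r) id
      continuous_const continuous_id).measurable

lemma measurable_outputFun (T : PatternTree k) (ε : ℝ) : Measurable (outputFun G T ε) :=
  (measurable_noisySum T ε).const_mul _

lemma measurable_fst_comp (g : (V → Fin (k + 1)) → ℝ) :
    Measurable fun q : (V → Fin (k + 1)) × (Fin k → V → ℝ) => g q.1 :=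
  (measurable_of_finite g).comp measurable_fst

lemma measurableSet_isGood (ε B : ℝ) :
    MeasurableSet {q : (V → Fin (k + 1)) × (Fin k → V → ℝ) | IsGood G ε B q} := by
  refine MeasurableSet.inter ?_ ?_
  · have : {q : (V → Fin (k + 1)) × (Fin k → V → ℝ) |
        ∀ ℓ i, ∑ j ∈ G.neighborFinset i, markInd q.1 ℓ j ≤ B} =
        ⋂ ℓ, ⋂ i, {q | ∑ j ∈ G.neighborFinset i, markInd q.1 ℓ j ≤ B} := by ext; simp
    change MeasurableSet {q : (V → Fin (k + 1)) × (Fin k → V → ℝ) |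
        ∀ ℓ i, ∑ j ∈ G.neighborFinset i, markInd q.1 ℓ j ≤ B}
    rw [this]
    exact MeasurableSet.iInter fun ℓ => MeasurableSet.iInter fun i =>
      measurableSet_le (measurable_fst_comp fun r => ∑ j ∈ G.neighborFinset i, markInd r ℓ j)
        measurable_const
  · have : {q : (V → Fin (k + 1)) × (Fin k → V → ℝ) | ∀ c i,
        ∑ j ∈ G.neighborFinset i, markInd q.1 (Fin.castSucc c) j + |q.2 c i| / ε ≤ B} =
        ⋂ c, ⋂ i, {q | ∑ j ∈ G.neighborFinset i, markInd q.1 (Fin.castSucc c) j +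
          |q.2 c i| / ε ≤ B} := by ext; simp
    change MeasurableSet {q : (V → Fin (k + 1)) × (Fin k → V → ℝ) | ∀ c i,
        ∑ j ∈ G.neighborFinset i, markInd q.1 (Fin.castSucc c) j + |q.2 c i| / ε ≤ B}
    rw [this]
    refine MeasurableSet.iInter fun c => MeasurableSet.iInter fun i =>
      measurableSet_le (Measurable.add (measurable_fst_comp fun r =>
        ∑ j ∈ G.neighborFinset i, markInd r (Fin.castSucc c) j) ?_) measurable_const
    exact Continuous.measurable (by fun_prop)

theorem integrable_outputFun (T : PatternTree k) {ε : ℝ} (hε : 0 < ε) :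
    Integrable (outputFun G T ε) ((markLaw V k).prod (noiseLaw V k)) := by
  have hb := ((integrable_noise_bound (V := V) ε k).const_mul
    (Fintype.card V : ℝ)).comp_snd (markLaw V k)
  refine (hb.mono' (measurable_noisySum T ε).aestronglyMeasurable
    (Filter.Eventually.of_forall fun q => ?_)).const_mul _
  have := abs_noisySum_le (G := G) hε T (markInd q.1) (initCount T q.1) q.2 (fun _ => 1)
    (abs_markInd_le_one _) (abs_initCount_le_one T _) fun _ => zero_le_one
  simpa using this

theorem integral_outputFun (T : PatternTree k) {ε : ℝ} (hε : 0 < ε) :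
    ∫ q, outputFun G T ε q ∂(markLaw V k).prod (noiseLaw V k) = T.patternCount G := by
  rw [integral_prod _ (integrable_outputFun T hε), ← integral_homSum_markInd, ← integral_const_mul]
  refine integral_congr_ae (Filter.Eventually.of_forall fun r => ?_)
  simp only [outputFun]
  rw [integral_const_mul, integral_noisySum hε T _ _ (abs_markInd_le_one r),
    markInd_mul_initCount]

/-- A large error forces a bad event, a large noise contribution on the good event, or a large
deviation of the marked count. The tail bound `hdev` and the probability `η` stay abstract so that
both regimes of `L` and `N` can be inserted. -/
theorem prod_real_deviation_le (T : PatternTree k) {ε : ℝ} (hε : 0 < ε) {B t δ τ η R : ℝ}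
    {d : ℕ} (hd : ∀ i, G.degree i ≤ d) (hB : 0 ≤ B) (hδ : 0 ≤ δ) (hτ : 0 < τ)
    (hdev : ∀ (b : V → ℝ) (A : ℝ), 0 ≤ A → (∀ i, |b i| ≤ A) →
      (noiseVec V).real {y | A * t < |∑ i, b i * y i|} ≤ δ)
    (hη : ((markLaw V k).prod (noiseLaw V k)).real {q | IsGood G ε B q}ᶜ ≤ η)
    (hR : ((k : ℝ) + 1) ^ (k + 1) * (k * (B ^ (k - 1) / ε * t)) + τ ≤ R) :
    ((markLaw V k).prod (noiseLaw V k)).real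
        {q | R < |outputFun G T ε q - T.patternCount G|} ≤
      η + k * δ + ((k : ℝ) + 1) ^ 2 * Fintype.card V * (((d : ℝ) + k + 1) ^ k) ^ 2 / τ ^ 2 := by
  set S : Set ((V → Fin (k + 1)) × (Fin k → V → ℝ)) := {q | IsGood G ε B q ∧
    k * (B ^ (k - 1) / ε * t) < |noisySum G ε k T (markInd q.1) (initCount T q.1) q.2 -
      homSum G k T (markInd q.1)|} with hS
  set U : Set ((V → Fin (k + 1)) × (Fin k → V → ℝ)) := {r | τ <
    |((k : ℝ) + 1) ^ (k + 1) * homSum G k T (markInd r) - T.patternCount G|} ×ˢ Set.univ with hU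
  have hSm : MeasurableSet S := by
    have h := ((measurable_noisySum (G := G) T ε).sub
      (measurable_fst_comp fun r => homSum G k T (markInd r))).abs
    exact (measurableSet_isGood ε B).inter (measurableSet_lt measurable_const h)
  have hSle : ((markLaw V k).prod (noiseLaw V k)).real S ≤ k * δ := by
    refine prod_real_le _ _ hSm (by positivity) fun r => ?_
    by_cases hr : ∀ ℓ i, ∑ j ∈ G.neighborFinset i, markInd r ℓ j ≤ B
    · refine le_trans (measureReal_mono fun z hz => ?_) (noiseLaw_deviation_le hε hB hδ hdev T
        (markInd r) (initCount T r) (fun _ => 1) (markInd_nonneg r) (markInd_le_one r)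
        (abs_initCount_le_one T r) (fun _ => zero_le_one) hr)
      obtain ⟨⟨-, h1⟩, h2⟩ := hz
      refine ⟨h1, ?_⟩
      rw [markInd_mul_initCount, Finset.prod_const_one, one_mul]
      exact h2
    · have : Prod.mk r ⁻¹' S = ∅ := by
        ext z
        simp only [Set.mem_preimage, Set.mem_empty_iff_false, iff_false]
        exact fun h => hr h.1.1
      rw [this, measureReal_empty]
      positivity
  have hUle : ((markLaw V k).prod (noiseLaw V k)).real U ≤
      ((k : ℝ) + 1) ^ 2 * Fintype.card V * (((d : ℝ) + k + 1) ^ k) ^ 2 / τ ^ 2 := by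
    rw [hU, measureReal_prod_prod, probReal_univ, mul_one]
    exact markLaw_real_deviation_le T hd hτ
  have hsub : {q | R < |outputFun G T ε q - T.patternCount G|} ⊆
      ({q | IsGood G ε B q}ᶜ ∪ S) ∪ U := by
    intro q hq
    by_contra h
    simp only [Set.mem_union, not_or, Set.mem_compl_iff, not_not] at h
    obtain ⟨⟨h1, h2⟩, h3⟩ := h
    have h2' : |noisySum G ε k T (markInd q.1) (initCount T q.1) q.2 -
        homSum G k T (markInd q.1)| ≤ k * (B ^ (k - 1) / ε * t) :=
      not_lt.1 fun h => h2 ⟨h1, h⟩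
    have h3' : |((k : ℝ) + 1) ^ (k + 1) * homSum G k T (markInd q.1) - T.patternCount G| ≤ τ :=
      not_lt.1 fun h => h3 ⟨h, trivial⟩
    have hpos : (0 : ℝ) ≤ ((k : ℝ) + 1) ^ (k + 1) := by positivity
    have h4 : outputFun G T ε q - T.patternCount G = ((k : ℝ) + 1) ^ (k + 1) *
        (noisySum G ε k T (markInd q.1) (initCount T q.1) q.2 - homSum G k T (markInd q.1)) +
        (((k : ℝ) + 1) ^ (k + 1) * homSum G k T (markInd q.1) - T.patternCount G) := by
      rw [outputFun]; ring
    have h5 : |outputFun G T ε q - T.patternCount G| ≤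
        ((k : ℝ) + 1) ^ (k + 1) * (k * (B ^ (k - 1) / ε * t)) + τ := by
      rw [h4]
      refine (abs_add_le _ _).trans (add_le_add ?_ h3')
      rw [abs_mul, abs_of_nonneg hpos]
      exact mul_le_mul_of_nonneg_left h2' hpos
    exact absurd (h5.trans hR) (not_le.2 hq)
  refine (measureReal_mono hsub).trans ((measureReal_union_le _ _).trans ?_)
  have := measureReal_union_le (μ := (markLaw V k).prod (noiseLaw V k)) {q | IsGood G ε B q}ᶜ S
  linarith

/-- A union bound over the tree vertices and the nodes. -/
lemma prod_real_not_isGood_le {ε B x y : ℝ}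
    (hx : ∀ ℓ i, (markLaw V k).real {r | B < ∑ j ∈ G.neighborFinset i, markInd r ℓ j} ≤ x)
    (hy : ∀ c i, ((markLaw V k).prod (noiseLaw V k)).real {q | B <
      ∑ j ∈ G.neighborFinset i, markInd q.1 (Fin.castSucc c) j + |q.2 c i| / ε} ≤ y)
    (hε : 0 < ε) :
    ((markLaw V k).prod (noiseLaw V k)).real {q | IsGood G ε B q}ᶜ ≤
      Fintype.card V * x + k * Fintype.card V * y := by
  set P := (markLaw V k).prod (noiseLaw V k)
  have hsub : {q | IsGood G ε B q}ᶜ ⊆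
      (⋃ i, ({r | B < ∑ j ∈ G.neighborFinset i, markInd r (Fin.last k) j} ×ˢ
        (Set.univ : Set (Fin k → V → ℝ)))) ∪
      ⋃ c, ⋃ i, {q | B <
        ∑ j ∈ G.neighborFinset i, markInd q.1 (Fin.castSucc c) j + |q.2 c i| / ε} := by
    intro q hq
    by_contra h
    simp only [Set.mem_union, Set.mem_iUnion, not_or, not_exists] at h
    obtain ⟨h1, h2⟩ := h
    have h2' : ∀ c i, ∑ j ∈ G.neighborFinset i, markInd q.1 (Fin.castSucc c) j +
        |q.2 c i| / ε ≤ B := fun c i => not_lt.1 (h2 c i)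
    refine hq ⟨fun ℓ i => ?_, h2'⟩
    -- Only the root mark needs its own estimate: for the other marks the bound with the nonnegative
    -- noise term is stronger.
    induction ℓ using Fin.lastCases with
    | last => exact not_lt.1 fun h => h1 i ⟨h, trivial⟩
    | cast c =>
      have := h2' c i
      have h0 : 0 ≤ |q.2 c i| / ε := by positivity
      linarith
  refine (measureReal_mono hsub).trans ((measureReal_union_le _ _).trans (add_le_add ?_ ?_))
  · refine (measureReal_iUnion_fintype_le _).trans
      ((Finset.sum_le_sum fun i _ => ?_).trans_eq (by simp [mul_comm] : ∑ _i : V, x = _))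
    rw [measureReal_prod_prod, probReal_univ, mul_one]
    exact hx _ _
  · refine (measureReal_iUnion_fintype_le _).trans ((Finset.sum_le_sum fun c _ =>
      (measureReal_iUnion_fintype_le _).trans (Finset.sum_le_sum fun i _ => hy c i)).trans_eq ?_)
    simp [mul_assoc]

end Combination

/-! ### Numerical estimates -/

section Estimates

open Real

lemma exp_sub_one_le {s : ℝ} (h0 : 0 ≤ s) (h1 : s ≤ 2 / 3) : exp s - 1 ≤ s + 3 / 4 * s ^ 2 := by
  have h := exp_bound' h0 (by linarith) (n := 3) (by norm_num)
  norm_num [Finset.sum_range_succ, Nat.factorial] at h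
  nlinarith [mul_nonneg h0 (sq_nonneg s), mul_le_mul_of_nonneg_left h1 (sq_nonneg s)]

/-- The choice of the parameter in Chernoff's bound. -/
lemma exists_chernoff_parameter {l ε L D : ℝ} (hl : 2 ≤ l) (hε : 0 < ε) (hε2 : ε ^ 2 ≤ 8 * l / 3)
    (hL : 0 < L) (hD : (l * √(8 * L) / ε) ^ 2 ≤ D) :
    ∃ s, 0 ≤ s ∧ s / ε ≤ 1 / 2 ∧
      -(s * ((D + l * √(8 * L) / ε * √D + l * √(8 * L) / ε) / l)) + D / l * (exp s - 1) ≤ -L := by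
  have hl0 : 0 < l := by linarith
  have h8 : √(8 * L) ^ 2 = 8 * L := sq_sqrt (by positivity)
  have hD1 : 8 * l ^ 2 * L ≤ D * ε ^ 2 := by
    rw [div_pow, mul_pow, h8, div_le_iff₀ (by positivity)] at hD
    linarith
  have hD0 : 0 < D := by
    by_contra h
    nlinarith [mul_pos (mul_pos hl0 hl0) hL, sq_nonneg ε, mul_nonneg (neg_nonneg.2 (not_lt.1 h)) (sq_nonneg ε)]
  -- Chosen so that the quadratic part of `exp s - 1`, bounded by `3/4 * s²`, costs exactly `L`
  -- after multiplication by `D / l`. The term with `√D` must then gain `2 * L`.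
  set s := √(4 * L * l / (3 * D)) with hs
  have hs0 : 0 ≤ s := sqrt_nonneg _
  have hs2 : s ^ 2 = 4 * L * l / (3 * D) := sq_sqrt (by positivity)
  have hsD : s ^ 2 * D = 4 * L * l / 3 := by rw [hs2]; field_simp
  have hsε : s ^ 2 * (6 * l) ≤ ε ^ 2 := by
    have : s ^ 2 * (6 * l) * D ≤ ε ^ 2 * D := by nlinarith
    exact le_of_mul_le_mul_right this hD0
  have hs1 : s ≤ 2 / 3 := by
    refine (sq_le_sq₀ (by positivity) (by norm_num)).1 ?_
    have : s ^ 2 * (6 * l) ≤ (2 / 3) ^ 2 * (6 * l) := by linarith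
    exact le_of_mul_le_mul_right this (by positivity)
  refine ⟨s, hs0, ?_, ?_⟩
  · rw [div_le_iff₀ hε]
    refine (sq_le_sq₀ (by positivity) (by positivity)).1 ?_
    nlinarith [sq_nonneg s]
  · have hsq : √D ^ 2 = D := sq_sqrt hD0.le
    -- After squaring, this is precisely the hypothesis `ε² ≤ 8 * l / 3`.
    have h2 : 2 * L * ε ≤ s * √(8 * L) * √D := by
      refine (sq_le_sq₀ (by positivity) (by positivity)).1 ?_
      rw [mul_pow, mul_pow, mul_pow, mul_pow, h8, hsq]
      have : s ^ 2 * (8 * L) * D = 4 * L * l / 3 * (8 * L) := by rw [← hsD]; ring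
      rw [this]
      nlinarith [mul_le_mul_of_nonneg_left hε2 (sq_nonneg L)]
    have h3 : 2 * L ≤ s * (√(8 * L) / ε * √D) := by
      have : s * (√(8 * L) / ε * √D) = s * √(8 * L) * √D / ε := by ring
      rw [this, le_div_iff₀ hε]
      exact h2
    have h4 : D / l * (exp s - 1) ≤ D / l * s + L := by
      calc D / l * (exp s - 1) ≤ D / l * (s + 3 / 4 * s ^ 2) :=
            mul_le_mul_of_nonneg_left (exp_sub_one_le hs0 hs1) (by positivity)
        _ = D / l * s + 3 / (4 * l) * (s ^ 2 * D) := by field_simp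
        _ = D / l * s + L := by rw [hsD]; field_simp
    have h5 : s * ((D + l * √(8 * L) / ε * √D + l * √(8 * L) / ε) / l) =
        D / l * s + s * (√(8 * L) / ε * √D) + s * √(8 * L) / ε := by field_simp
    have h6 : 0 ≤ s * √(8 * L) / ε := by positivity
    rw [h5]
    linarith

lemma factorial_succ_le (k : ℕ) : (k + 1).factorial ≤ (k + 1) ^ k := by
  induction k with
  | zero => simp
  | succ k ih =>
    rw [Nat.factorial_succ, pow_succ, mul_comm]
    exact Nat.mul_le_mul_right _ (ih.trans (Nat.pow_le_pow_left (by omega) _))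

/-- When `L` is large, powers of `L` are small compared with `exp (L / 2)`. -/
lemma pow_mul_le_exp_half {k : ℕ} (hk : 2 ≤ k) {L : ℝ} (hL : 77 * ((k : ℝ) + 1) ≤ L) :
    18 * k * (69 / 1000 * L / (k + 1)) ^ k * (9 / 8 * L) ≤ exp (L / 2) / (3 * k) := by
  have hk2 : (2 : ℝ) ≤ k := by exact_mod_cast hk
  have hL0 : 0 < L := by linarith
  have hl0 : (0 : ℝ) < (k : ℝ) + 1 := by positivity
  -- The left side of the goal has degree `k + 1` in `L`. The term of degree `k + 2` of the
  -- exponential series leaves one spare factor `L ≥ 77 * (k + 1)`, which pays for the constants and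
  -- a factor linear in `k`; powers of `138/1000` absorb `k²`.
  have h1 : (L / 2) ^ (k + 2) / ((k + 2).factorial : ℝ) ≤ exp (L / 2) :=
    pow_div_factorial_le_exp _ (by positivity) _
  have h2 : ((k + 2).factorial : ℝ) ≤ ((k : ℝ) + 2) * ((k : ℝ) + 1) ^ k := by
    have := Nat.mul_le_mul_left (k + 2) (factorial_succ_le k)
    rw [← Nat.factorial_succ] at this
    exact_mod_cast this
  have h3 : (L / 2) ^ (k + 2) / (((k : ℝ) + 2) * ((k : ℝ) + 1) ^ k) ≤ exp (L / 2) := by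
    refine le_trans ?_ h1
    gcongr
  rw [le_div_iff₀ (by positivity)]
  refine le_trans ?_ h3
  rw [le_div_iff₀ (by positivity)]
  have h4 : (k : ℝ) ^ 2 ≤ 4 ^ k / 4 := by
    have : k ≤ 2 ^ (k - 1) := by
      have := Nat.lt_two_pow_self (n := k - 1)
      omega
    have h : (k : ℝ) * 2 ≤ 2 ^ k := by
      obtain ⟨m, rfl⟩ : ∃ m, k = m + 1 := ⟨k - 1, by omega⟩
      rw [pow_succ]
      have : ((m + 1 : ℕ) : ℝ) ≤ 2 ^ m := by exact_mod_cast this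
      linarith
    have h' : ((k : ℝ) * 2) ^ 2 ≤ (2 ^ k) ^ 2 := by gcongr
    rw [← pow_mul, mul_comm k 2, pow_mul] at h'
    norm_num at h'
    linarith
  have h5 : (4 * (138 / 1000) : ℝ) ^ k ≤ (4 * (138 / 1000)) ^ 2 :=
    pow_le_pow_of_le_one (by norm_num) (by norm_num) hk
  have h6 : (138 / 1000 : ℝ) ^ k * (k : ℝ) ^ 2 ≤ (4 * (138 / 1000)) ^ 2 / 4 := by
    rw [mul_pow] at h5
    have := mul_le_mul_of_nonneg_left h4 (by positivity : (0 : ℝ) ≤ (138 / 1000) ^ k)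
    linarith
  have e1 : (69 / 1000 * L / ((k : ℝ) + 1)) ^ k * ((k : ℝ) + 1) ^ k =
      (138 / 1000) ^ k * (L / 2) ^ k := by
    rw [← mul_pow, ← mul_pow]
    congr 1
    field_simp
    norm_num
  calc 18 * k * (69 / 1000 * L / (k + 1)) ^ k * (9 / 8 * L) * (3 * k) *
        (((k : ℝ) + 2) * ((k : ℝ) + 1) ^ k)
      = 243 / 4 * ((k : ℝ) + 2) * (k : ℝ) ^ 2 * L * ((69 / 1000 * L / ((k : ℝ) + 1)) ^ k *
          ((k : ℝ) + 1) ^ k) := by ring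
    _ = 243 / 4 * ((k : ℝ) + 2) * ((138 / 1000) ^ k * (k : ℝ) ^ 2) * L * (L / 2) ^ k := by
        rw [e1]; ring
    _ ≤ 243 / 4 * ((k : ℝ) + 2) * ((4 * (138 / 1000)) ^ 2 / 4) * L * (L / 2) ^ k := by gcongr
    _ ≤ L / 4 * L * (L / 2) ^ k := by
        gcongr
        nlinarith
    _ = (L / 2) ^ (k + 2) := by rw [pow_add]; ring

/-- The alternative that replaces subgaussian concentration when there are few nodes. -/
lemma noise_alternative {k : ℕ} (hk : 2 ≤ k) {N L ε : ℝ} (hN : 1 ≤ N) (hNL : N ≤ L) (hε : 0 < ε)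
    (hε2 : ε ^ 2 ≤ 8 * ((k : ℝ) + 1) / 3) :
    3 * L * (N + L / ε) ^ (k - 1) ≤ √(8 * L) * √N * (16 * ((k : ℝ) + 1) * L / ε ^ 2) ^ (k - 1) ∨
      18 * k * (L / ε) * (N + L / ε) ^ (k - 1) ≤ exp (L / 2) / (3 * k) := by
  obtain ⟨m, rfl⟩ : ∃ m, k = m + 1 := ⟨k - 1, by omega⟩
  have hm : 1 ≤ m := by omega
  rw [Nat.add_sub_cancel]
  set l : ℝ := ((m + 1 : ℕ) : ℝ) + 1 with hl
  have hl3 : 3 ≤ l := by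
    have : (1 : ℝ) ≤ m := by exact_mod_cast hm
    rw [hl]; push_cast; linarith
  have hL : 0 < L := by linarith
  have hl0 : 0 < l := by linarith
  rw [or_iff_not_imp_left, not_le]
  intro h
  set W := 16 * l * L / ε ^ 2 with hW
  have hW0 : 0 < W := by positivity
  set ρ := (N + L / ε) / W with hρ
  -- The number `ρ` compares the crude message bound with `W`. Failure of the first alternative will
  -- say that `N / L` is at most `9/8 * ρ ^ (2m)`.
  have hρ0 : 0 < ρ := by positivity
  have hY : N + L / ε = ρ * W := by rw [hρ]; field_simp
  set e := ε / (16 * l) with he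
  have he0 : 0 < e := by positivity
  have he2 : e ^ 2 ≤ 1 / (96 * l) := by
    rw [he, div_pow, div_le_div_iff₀ (by positivity) (by positivity)]
    nlinarith
  have he3 : e ≤ 59 / 1000 := by
    refine (sq_le_sq₀ he0.le (by norm_num)).1 (he2.trans ?_)
    rw [div_le_iff₀ (by positivity)]
    linarith
  have hρe : ρ ≤ N / L / 6 + e := by
    have h1 : ρ = N / L * (ε ^ 2 / (16 * l)) + e := by
      rw [hρ, hW, he]; field_simp
    have h2 : ε ^ 2 / (16 * l) ≤ 1 / 6 := by
      rw [div_le_iff₀ (by positivity)]; linarith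
    rw [h1]
    have := mul_le_mul_of_nonneg_left h2 (by positivity : 0 ≤ N / L)
    linarith
  have hNL1 : N / L ≤ 1 := (div_le_one hL).2 hNL
  have hρ1 : ρ ≤ 23 / 100 := by linarith
  have h9 : 8 * (N / L) ≤ 9 * ρ ^ (2 * m) := by
    rw [hY, mul_pow, ← mul_assoc] at h
    have h' := lt_of_mul_lt_mul_right h (by positivity)
    have h'' : (√(8 * L) * √N) ^ 2 < (3 * L * ρ ^ m) ^ 2 := by
      exact pow_lt_pow_left₀ h' (by positivity) (by norm_num)
    rw [mul_pow, sq_sqrt (by positivity), sq_sqrt (by positivity), mul_pow, ← pow_mul,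
      mul_comm m 2] at h''
    rw [← mul_div_assoc, div_le_iff₀ hL]
    have h3 : L * (8 * N) ≤ L * (9 * ρ ^ (2 * m) * L) := by linarith
    exact le_of_mul_le_mul_left h3 hL
  -- Since `N / L` is then of order `ρ²`, the inequality `ρ ≤ N / L / 6 + e` bootstraps to `ρ ≤ 1.05
  -- * e`. This uses `m ≥ 1`, that is `k ≥ 2`.
  have hρ2 : ρ ^ (2 * m) ≤ ρ ^ 2 := pow_le_pow_of_le_one hρ0.le (by linarith) (by omega)
  set g := 105 / 100 * e with hg
  have hg0 : 0 < g := by positivity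
  have hρg : ρ ≤ g := by nlinarith
  set a := g⁻¹ with ha
  have ha0 : 0 < a := by positivity
  have ha1 : 1 ≤ a := (one_le_inv₀ hg0).2 (by rw [hg]; linarith)
  -- Because `N ≥ 1`, the ratio `N / L` is at least `1 / L`, so `ε` cannot be too small compared
  -- with `L`.
  have ha2 : a ^ (2 * m) ≤ 9 / 8 * L := by
    rw [ha, inv_pow]
    rw [inv_le_iff_one_le_mul₀ (by positivity)]
    have h1 : ρ ^ (2 * m) ≤ g ^ (2 * m) := by gcongr
    have h2 : 8 * N ≤ 9 * ρ ^ (2 * m) * L := by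
      rw [← mul_div_assoc, div_le_iff₀ hL] at h9; exact h9
    nlinarith [mul_le_mul_of_nonneg_right h1 hL.le]
  -- The upper bound on `ε` forces `a²` to be at least a constant times `l`, so the bound on `a ^ (2
  -- * m)` makes `L` large.
  have hLl : 77 * l ≤ L := by
    have h1 : a ^ 2 ≤ a ^ (2 * m) := pow_le_pow_right₀ ha1 (by omega)
    have h2 : g ^ 2 * a ^ 2 = 1 := by rw [← mul_pow, ha, mul_inv_cancel₀ hg0.ne', one_pow]
    have h3 : g ^ 2 ≤ 11025 / 10000 * (1 / (96 * l)) := by rw [hg, mul_pow]; linarith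
    have h4 : 1 ≤ 11025 / 10000 * (1 / (96 * l)) * (9 / 8 * L) := by
      refine h2.symm.le.trans ?_
      exact mul_le_mul h3 (h1.trans ha2) (by positivity) (by positivity)
    have h5 : 11025 / 10000 * (1 / (96 * l)) * (9 / 8 * L) =
        11025 / 10000 * (9 / 8) / 96 * L / l := by field_simp
    rw [h5, le_div_iff₀ hl0] at h4
    linarith
  have hLε : L / ε = 105 / 1600 * (L * a / l) := by
    rw [ha, hg, he]; field_simp; norm_num
  have hc0 : 0 ≤ L * a / l := by positivity
  have hY2 : N + L / ε ≤ 69 / 1000 * L / l * a := by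
    have : N + L / ε ≤ 105 / 100 * (L / ε) := by
      rw [hY]
      refine (mul_le_mul_of_nonneg_right hρg hW0.le).trans (le_of_eq ?_)
      rw [hg, he, hW]; field_simp
    have h2 : 69 / 1000 * L / l * a = 69 / 1000 * (L * a / l) := by ring
    rw [h2]
    linarith
  have hLε2 : L / ε ≤ 69 / 1000 * L / l * a := by linarith
  refine le_trans ?_ (pow_mul_le_exp_half (k := m + 1) (by omega) hLl)
  have hε0 : 0 ≤ L / ε := by positivity
  -- Here `m + 1 ≤ 2 * m`: all powers of `a` together cost only one factor of order `L`.
  have haa : a ^ (m + 1) ≤ 9 / 8 * L := (pow_le_pow_right₀ ha1 (by omega)).trans ha2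
  calc 18 * ((m + 1 : ℕ) : ℝ) * (L / ε) * (N + L / ε) ^ m
      ≤ 18 * ((m + 1 : ℕ) : ℝ) * (69 / 1000 * L / l * a) * (69 / 1000 * L / l * a) ^ m := by
        gcongr
    _ = 18 * ((m + 1 : ℕ) : ℝ) * (69 / 1000 * L / l) ^ (m + 1) * a ^ (m + 1) := by
        rw [pow_succ, mul_pow, pow_succ]; ring
    _ ≤ 18 * ((m + 1 : ℕ) : ℝ) * (69 / 1000 * L / l) ^ (m + 1) * (9 / 8 * L) := by gcongr

end Estimates

/-! ### The error bound in the two regimes -/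

section ErrorBound

open Real

variable {V : Type*} [Fintype V] {G : SimpleGraph V} [DecidableRel G.Adj] {k : ℕ}

lemma log_pos_and_exp_neg {k N : ℕ} {β : ℝ} (hk : 1 ≤ k) (hN : 1 ≤ N) (hβ0 : 0 < β)
    (hβ1 : β < 1) :
    0 < log (12 * k * N / β) ∧ exp (-log (12 * k * N / β)) = β / (12 * k * N) := by
  have hk' : (1 : ℝ) ≤ k := by exact_mod_cast hk
  have hN' : (1 : ℝ) ≤ N := by exact_mod_cast hN
  constructor
  · refine log_pos ?_
    rw [lt_div_iff₀ hβ0]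
    nlinarith
  · rw [exp_neg, exp_log (by positivity), inv_div]

lemma sq_le_of_le_sqrt {ε x : ℝ} (hε : 0 < ε) (h : ε ≤ √x) : ε ^ 2 ≤ x :=
  (le_sqrt' hε).1 h

lemma sq_noiseFactor_le_dHat (k N d : ℕ) (ε β : ℝ) : noiseFactor k N ε β ^ 2 ≤ dHat k N d ε β := by
  unfold dHat
  refine (Nat.le_ceil _).trans ?_
  exact_mod_cast le_max_right _ _

lemma le_dHat (k N d : ℕ) (ε β : ℝ) : (d : ℝ) ≤ dHat k N d ε β := by
  unfold dHat
  exact_mod_cast le_max_left _ _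

/-- Chebyshev's failure probability when the marks may use `c` times the first error term. The
values `c = 1` and `c = 5/6` are used. -/
lemma deviation_term_eq {n l β X : ℝ} (hn : 0 < n) (hl : 0 < l) (hβ : 0 < β) (hX : 0 < X) (c : ℝ) :
    l ^ 2 * n * X ^ 2 / (c * (l * √(2 * n / β) * X)) ^ 2 = β / (2 * c ^ 2) := by
  rw [mul_pow, mul_pow, mul_pow, sq_sqrt (by positivity)]
  by_cases hc : c = 0
  · simp [hc]
  · field_simp

theorem prod_real_error_le_of_log_le (T : PatternTree k) (hk : 1 ≤ k) {ε β : ℝ} (hε : 0 < ε)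
    (hε2 : ε ≤ √(8 * ((k : ℝ) + 1) / 3)) (hβ0 : 0 < β) (hβ1 : β < 1) (hN : 1 ≤ Fintype.card V)
    (hL : log (12 * k * Fintype.card V / β) ≤ Fintype.card V) :
    ((markLaw V k).prod (noiseLaw V k)).real
      {q | errorBound k (Fintype.card V) G.maxDegree ε β <
        |outputFun G T ε q - T.patternCount G|} ≤ β := by
  obtain ⟨hL0, hexp⟩ := log_pos_and_exp_neg hk hN hβ0 hβ1
  set N := Fintype.card V
  set d := G.maxDegree
  set L := log (12 * k * N / β) with hLdef
  set γ := noiseFactor k N ε β with hγ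
  have hγ' : γ = ((k : ℝ) + 1) * √(8 * L) / ε := rfl
  set D := dHat k N d ε β with hD
  have hk' : (1 : ℝ) ≤ k := by exact_mod_cast hk
  have hN' : (1 : ℝ) ≤ N := by exact_mod_cast hN
  have hγ0 : 0 ≤ γ := by rw [hγ']; positivity
  have hγD : γ ^ 2 ≤ D := sq_noiseFactor_le_dHat _ _ _ _ _
  have hdD : (d : ℝ) ≤ D := le_dHat _ _ _ _ _
  have hD0 : 0 ≤ D := (sq_nonneg _).trans hγD
  have hdeg : ∀ i, ((G.neighborFinset i).card : ℝ) ≤ D := fun i =>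
    le_trans (by exact_mod_cast G.degree_le_maxDegree i) hdD
  set B := (D + γ * √D + γ) / ((k : ℝ) + 1) with hB
  have hB0 : 0 ≤ B := by positivity
  obtain ⟨s, hs0, hsε, hs⟩ := exists_chernoff_parameter (l := (k : ℝ) + 1) (by linarith) hε
    (sq_le_of_le_sqrt hε hε2) hL0 hγD
  have hη := prod_real_not_isGood_le (G := G) (k := k) (B := B) (x := exp (-L))
    (y := 2 * exp (-L))
    (fun ℓ i => (markLaw_real_lt_sum_le hs0 _ (hdeg i) ℓ B).trans (exp_le_exp.2 hs))
    (fun c i => (prod_real_lt_sum_add_le hs0 hsε _ (hdeg i) (Fin.castSucc c) c i B).trans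
      (mul_le_mul_of_nonneg_left (exp_le_exp.2 hs) zero_le_two)) hε
  -- The parameter `√(L / (2N))` minimises `-s * t + 2 * s² * N` at `t = √(8NL)`. Its square is at
  -- most `1/2` exactly when `L ≤ N`.
  have hσ2 : √(L / (2 * N)) ^ 2 = L / (2 * N) := sq_sqrt (by positivity)
  have hst : √(L / (2 * N)) * √(8 * N * L) = 2 * L := by
    rw [← sqrt_mul (by positivity), show L / (2 * N) * (8 * N * L) = (2 * L) ^ 2 by field_simp; ring,
      sqrt_sq (by positivity)]
  have hdev : ∀ (b : V → ℝ) (A : ℝ), 0 ≤ A → (∀ i, |b i| ≤ A) →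
      (noiseVec V).real {y | A * √(8 * N * L) < |∑ i, b i * y i|} ≤ 2 * exp (-L) := by
    intro b A hA hb
    refine (noiseVec_real_lt_abs_sum_le hA hb _ (sqrt_nonneg (L / (2 * N))) ?_).trans (le_of_eq ?_)
    · rw [hσ2, div_le_iff₀ (by positivity)]
      linarith
    · rw [hst, hσ2]
      congr 2
      change -(2 * L) + 2 * (L / (2 * N)) * (N : ℝ) = -L
      field_simp
      ring
  have hX : 0 < ((d : ℝ) + k + 1) ^ k := by positivity
  have hR : ((k : ℝ) + 1) ^ (k + 1) * (k * (B ^ (k - 1) / ε * √(8 * N * L))) +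
      1 * (((k : ℝ) + 1) * √(2 * N / β) * ((d : ℝ) + k + 1) ^ k) ≤ errorBound k N d ε β := by
    -- The denominators `(k+1)^(k-1)` from `B ^ (k-1)` cancel against the rescaling and leave
    -- `(k+1)²`; one factor `k + 1` is absorbed by `γ`.
    refine le_of_eq ?_
    obtain ⟨m, rfl⟩ : ∃ m, k = m + 1 := ⟨k - 1, by omega⟩
    have h8 : √(8 * N * L) = √(8 * L) * √N := by
      rw [← sqrt_mul (by positivity)]; congr 1; ring
    rw [errorBound, ← hγ, ← hD, h8, Nat.add_sub_cancel, hB, div_pow]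
    generalize D + γ * √D + γ = Y
    have hl : ((m + 1 : ℕ) : ℝ) + 1 ≠ 0 := by positivity
    rw [hγ', pow_succ, pow_succ]
    field_simp
    ring
  refine (prod_real_deviation_le T hε G.degree_le_maxDegree hB0 (by positivity)
    (by positivity) hdev hη hR).trans ?_
  rw [deviation_term_eq (by positivity) (by positivity) hβ0 hX, hexp]
  change (N : ℝ) * (β / (12 * k * N)) + k * N * (2 * (β / (12 * k * N))) +
    k * (2 * (β / (12 * k * N))) + β / (2 * 1 ^ 2) ≤ β
  have e1 : (N : ℝ) * (β / (12 * k * N)) = β / 12 * (1 / k) := by field_simp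
  have e2 : (k : ℝ) * N * (2 * (β / (12 * k * N))) = β / 6 := by field_simp; norm_num
  have e3 : (k : ℝ) * (2 * (β / (12 * k * N))) = β / 6 * (1 / N) := by field_simp; norm_num
  have h1 : 1 / (k : ℝ) ≤ 1 := (div_le_one (by positivity)).2 hk'
  have h2 : 1 / (N : ℝ) ≤ 1 := (div_le_one (by positivity)).2 hN'
  rw [e1, e2, e3]
  nlinarith

/-- With few nodes the degree bounds the marked neighbours deterministically, so only the size of
the individual noise variables can violate the good event. -/
theorem prod_real_error_le_of_le_log (T : PatternTree k) (hk : 2 ≤ k) {ε β : ℝ} (hε : 0 < ε)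
    (hε2 : ε ≤ √(8 * ((k : ℝ) + 1) / 3)) (hβ0 : 0 < β) (hβ1 : β < 1) (hN : 1 ≤ Fintype.card V)
    (hL : Fintype.card V ≤ log (12 * k * Fintype.card V / β)) :
    ((markLaw V k).prod (noiseLaw V k)).real
      {q | errorBound k (Fintype.card V) G.maxDegree ε β <
        |outputFun G T ε q - T.patternCount G|} ≤ β := by
  have hk1 : 1 ≤ k := by omega
  obtain ⟨hL0, hexp⟩ := log_pos_and_exp_neg hk1 hN hβ0 hβ1
  have hdN : (G.maxDegree : ℝ) ≤ Fintype.card V := by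
    have : Nonempty V := Fintype.card_pos_iff.1 hN
    exact_mod_cast G.maxDegree_lt_card_verts.le
  set N := Fintype.card V
  set d := G.maxDegree
  set L := log (12 * k * N / β) with hLdef
  set γ := noiseFactor k N ε β with hγ
  have hγ' : γ = ((k : ℝ) + 1) * √(8 * L) / ε := rfl
  set D := dHat k N d ε β with hD
  have hk' : (1 : ℝ) ≤ k := by exact_mod_cast hk1
  have hN' : (1 : ℝ) ≤ N := by exact_mod_cast hN
  have hγ0 : 0 ≤ γ := by rw [hγ']; positivity
  have hγD : γ ^ 2 ≤ D := sq_noiseFactor_le_dHat _ _ _ _ _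
  have hdeg : ∀ i, ((G.neighborFinset i).card : ℝ) ≤ d := fun i => by
    exact_mod_cast G.degree_le_maxDegree i
  have hcount : ∀ (r : V → Fin (k + 1)) ℓ i, ∑ j ∈ G.neighborFinset i, markInd r ℓ j ≤ d :=
    fun r ℓ i => ((Finset.sum_le_sum fun j _ => markInd_le_one r ℓ j).trans_eq
      (by simp)).trans (hdeg i)
  set B := (d : ℝ) + L / ε with hB
  have hB0 : 0 ≤ B := by positivity
  have hη := prod_real_not_isGood_le (G := G) (k := k) (ε := ε) (B := B) (x := 0)
    (y := exp (-L)) (fun ℓ i => ?_) (fun c i => ?_) hε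
  rotate_left
  · have : {r : V → Fin (k + 1) | B < ∑ j ∈ G.neighborFinset i, markInd r ℓ j} = ∅ := by
      ext r
      simp only [Set.mem_ofPred_eq, Set.mem_empty_iff_false, iff_false, not_lt]
      have : 0 ≤ L / ε := by positivity
      linarith [hcount r ℓ i]
    rw [this, measureReal_empty]
  · rw [← noiseLaw_real_lt_abs hL0.le c i]
    refine (measureReal_mono (s₂ := Set.univ ×ˢ {z : Fin k → V → ℝ | L < |z c i|}) fun q hq => ⟨trivial, ?_⟩).trans
      (le_of_eq ?_)
    · have h1 : B < ∑ j ∈ G.neighborFinset i, markInd q.1 (Fin.castSucc c) j + |q.2 c i| / ε := hq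
      have h2 : L / ε < |q.2 c i| / ε := by linarith [hcount q.1 (Fin.castSucc c) i]
      exact (div_lt_div_iff_of_pos_right hε).1 h2
    · rw [measureReal_prod_prod, probReal_univ, one_mul]
  have hdev : ∀ (b : V → ℝ) (A : ℝ), 0 ≤ A → (∀ i, |b i| ≤ A) →
      (noiseVec V).real {y | A * (3 * L) < |∑ i, b i * y i|} ≤ 2 * exp (-L) := by
    intro b A hA hb
    -- With `s = 2/3` the exponent is `-2 * L + 8/9 * N`, which is at most `-L` because `N ≤ L`.
    refine (noiseVec_real_lt_abs_sum_le hA hb _ (s := 2 / 3) (by norm_num) (by norm_num)).trans ?_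
    gcongr
    change -(2 / 3 * (3 * L)) + 2 * (2 / 3) ^ 2 * (N : ℝ) ≤ -L
    linarith
  have hX : 0 < ((d : ℝ) + k + 1) ^ k := by positivity
  have hl0 : (0 : ℝ) < (k : ℝ) + 1 := by positivity
  set F := ((k : ℝ) + 1) * √(2 * N / β) * ((d : ℝ) + k + 1) ^ k with hF
  have hF0 : 0 ≤ F := by positivity
  have hnoise : ((k : ℝ) + 1) ^ (k + 1) * (k * (B ^ (k - 1) / ε * (3 * L))) ≤
      k * (k + 1) * γ * √(N : ℝ) * (D + γ * √D + γ) ^ (k - 1) + 1 / 6 * F := by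
    have hsec : 0 ≤ k * (k + 1) * γ * √(N : ℝ) * (D + γ * √D + γ) ^ (k - 1) := by
      have : 0 ≤ D := (sq_nonneg _).trans hγD
      positivity
    have hBN : B ≤ N + L / ε := by rw [hB]; linarith
    rcases noise_alternative hk hN' hL hε (sq_le_of_le_sqrt hε hε2) with h | h
    -- The left side is `2γ²`, and `d̂ ≥ γ²` bounds both `d̂` and `γ√d̂` from below by `γ²`.
    · have hW : 16 * ((k : ℝ) + 1) * L / ε ^ 2 * (k + 1) ≤ D + γ * √D + γ := by
        have h1 : 16 * ((k : ℝ) + 1) * L / ε ^ 2 * (k + 1) = 2 * γ ^ 2 := by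
          rw [hγ', div_pow, mul_pow, sq_sqrt (by positivity)]
          ring
        have h2 : γ ≤ √D := le_sqrt_of_sq_le hγD
        rw [h1]
        nlinarith
      have h1 : ((k : ℝ) + 1) ^ (k + 1) * (k * (B ^ (k - 1) / ε * (3 * L))) ≤
          k * (k + 1) * γ * √(N : ℝ) * (D + γ * √D + γ) ^ (k - 1) := by
        calc ((k : ℝ) + 1) ^ (k + 1) * (k * (B ^ (k - 1) / ε * (3 * L)))
            = ((k : ℝ) + 1) ^ (k + 1) * k / ε * (3 * L * B ^ (k - 1)) := by ring
          _ ≤ ((k : ℝ) + 1) ^ (k + 1) * k / ε *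
              (√(8 * L) * √N * (16 * ((k : ℝ) + 1) * L / ε ^ 2) ^ (k - 1)) := by
              refine mul_le_mul_of_nonneg_left (le_trans ?_ h) (by positivity)
              gcongr
          _ = k * (k + 1) * γ * √(N : ℝ) *
              (16 * ((k : ℝ) + 1) * L / ε ^ 2 * (k + 1)) ^ (k - 1) := by
              have : ((k : ℝ) + 1) ^ (k + 1) = ((k : ℝ) + 1) ^ 2 * ((k : ℝ) + 1) ^ (k - 1) := by
                rw [← pow_add]; congr 1; omega
              rw [this, mul_pow (16 * ((k : ℝ) + 1) * L / ε ^ 2), hγ']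
              ring
          _ ≤ _ := by gcongr
      linarith
    -- By the definition of `L`, `exp (L / 2)` equals `√(12kN/β)`; this turns the exponential of the
    -- second alternative into the square root of the Chebyshev term.
    · have h1 : exp (L / 2) / (3 * k) ≤ √(2 * N / β) := by
        refine le_sqrt_of_sq_le ?_
        have h2 : exp (L / 2) ^ 2 = 12 * k * N / β := by
          rw [← exp_nat_mul]
          push_cast
          rw [mul_div_cancel₀ L two_ne_zero, hLdef, exp_log (by positivity)]
        rw [div_pow, h2, div_le_iff₀ (by positivity)]
        have h3 : 2 * (N : ℝ) / β * (3 * k) ^ 2 = 18 * k * k * N / β := by ring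
        rw [h3]
        gcongr
        nlinarith
      have h2 : ((k : ℝ) + 1) ^ (k + 1) * (k * (B ^ (k - 1) / ε * (3 * L))) ≤ 1 / 6 * F := by
        calc ((k : ℝ) + 1) ^ (k + 1) * (k * (B ^ (k - 1) / ε * (3 * L)))
            = 1 / 6 * (((k : ℝ) + 1) ^ (k + 1) * (18 * k * (L / ε) * B ^ (k - 1))) := by ring
          _ ≤ 1 / 6 * (((k : ℝ) + 1) ^ (k + 1) * √(2 * N / β)) := by
              have : 18 * k * (L / ε) * B ^ (k - 1) ≤ √(2 * N / β) := by
                refine le_trans ?_ (h.trans h1)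
                gcongr
              gcongr
          _ = 1 / 6 * (((k : ℝ) + 1) * √(2 * N / β) * ((k : ℝ) + 1) ^ k) := by ring
          _ ≤ 1 / 6 * F := by
              rw [hF]
              have : (k : ℝ) + 1 ≤ (d : ℝ) + k + 1 := by
                have : (0 : ℝ) ≤ d := by positivity
                linarith
              gcongr
      linarith
  -- The noise may consume one sixth of the first term `F`, so the marks get the remaining `5/6`.
  -- Their failure probability `18/25 * β` plus at most `β/4` for the noise stays below `β`.
  have hR : ((k : ℝ) + 1) ^ (k + 1) * (k * (B ^ (k - 1) / ε * (3 * L))) + 5 / 6 * F ≤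
      errorBound k N d ε β := by
    rw [errorBound, ← hγ, ← hD, ← hF]
    linarith
  have hF1 : 0 < F := by rw [hF]; positivity
  refine (prod_real_deviation_le T hε G.degree_le_maxDegree hB0 (by positivity)
    (by positivity) hdev hη hR).trans ?_
  rw [hF, deviation_term_eq (by positivity) (by positivity) hβ0 hX, hexp]
  change (N : ℝ) * 0 + k * N * (β / (12 * k * N)) + k * (2 * (β / (12 * k * N))) +
    β / (2 * (5 / 6) ^ 2) ≤ β
  have e2 : (k : ℝ) * N * (β / (12 * k * N)) = β / 12 := by field_simp
  have e3 : (k : ℝ) * (2 * (β / (12 * k * N))) = β / 6 * (1 / N) := by field_simp; norm_num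
  have h2 : 1 / (N : ℝ) ≤ 1 := (div_le_one (by positivity)).2 hN'
  have h3 := mul_le_mul_of_nonneg_left h2 (by positivity : 0 ≤ β / 6)
  have h4 : β / (2 * (5 / 6) ^ 2) = 18 / 25 * β := by ring
  rw [e2, e3, h4, mul_zero]
  linarith

/-- The error bound of the mechanism. -/
theorem law_real_error_le (T : PatternTree k) (hk : 1 ≤ k) {ε β : ℝ} (hε : 0 < ε)
    (hε2 : ε ≤ √(8 * ((k : ℝ) + 1) / 3)) (hβ0 : 0 < β) (hβ1 : β < 1)
    (hL : k = 1 → log (12 * k * Fintype.card V / β) ≤ Fintype.card V) :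
    ((markLaw V k).prod (noiseLaw V k)).real
      {q | errorBound k (Fintype.card V) G.maxDegree ε β <
        |outputFun G T ε q - T.patternCount G|} ≤ β := by
  -- Without nodes the logarithm carries no information, but both output and count are zero.
  rcases Nat.eq_zero_or_pos (Fintype.card V) with hN | hN
  · have hV : IsEmpty V := Fintype.card_eq_zero_iff.1 hN
    have h1 : ∀ q, outputFun G T ε q = 0 := fun q => by
      have := abs_noisySum_le (G := G) hε T (markInd q.1) (initCount T q.1) q.2 (fun _ => 1)
        (abs_markInd_le_one _) (abs_initCount_le_one T _) fun _ => zero_le_one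
      rw [hN, Nat.cast_zero, zero_mul, zero_mul] at this
      rw [outputFun, abs_nonpos_iff.1 this, mul_zero]
    have h2 : (occurrences G T).card = 0 := by
      have : IsEmpty (Fin (k + 1) → V) := ⟨fun f => hV.elim (f 0)⟩
      exact Finset.card_eq_zero.2 (Finset.eq_empty_of_isEmpty _)
    have h3 : 0 ≤ errorBound k (Fintype.card V) G.maxDegree ε β := by
      have : 0 ≤ noiseFactor k (Fintype.card V) ε β := by unfold noiseFactor; positivity
      have : 0 ≤ dHat k (Fintype.card V) G.maxDegree ε β := by unfold dHat; positivity
      unfold errorBound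
      positivity
    have : {q | errorBound k (Fintype.card V) G.maxDegree ε β <
        |outputFun G T ε q - T.patternCount G|} = ∅ := by
      ext q
      simp only [h1, patternCount_eq_card, h2, Nat.cast_zero, sub_zero, abs_zero,
        Set.mem_ofPred_eq, Set.mem_empty_iff_false, iff_false, not_lt, h3]
    rw [this, measureReal_empty]
    exact hβ0.le
  · rcases le_total (log (12 * k * Fintype.card V / β)) (Fintype.card V) with h | h
    · exact prod_real_error_le_of_log_le T hk hε hε2 hβ0 hβ1 hN h
    · by_cases hk1 : k = 1
      · exact prod_real_error_le_of_log_le T hk hε hε2 hβ0 hβ1 hN (hL hk1)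
      · exact prod_real_error_le_of_le_log T (by omega) hε hε2 hβ0 hβ1 hN h

end ErrorBound

/-! ### Asymptotic form of the error bound -/

section Asymptotics

variable {k : ℕ} {ε β : ℝ}

lemma noiseFactor_nonneg (k N : ℕ) (hε : 0 < ε) (β : ℝ) : 0 ≤ noiseFactor k N ε β := by
  unfold noiseFactor; positivity

lemma exists_noiseFactor_le (hk : 1 ≤ k) (hε : 0 < ε) (hβ0 : 0 < β) (hβ1 : β < 1) :
    ∃ A : ℝ, 1 ≤ A ∧ ∀ N : ℕ, 2 ≤ N → noiseFactor k N ε β ≤ A * (2 * Real.log N) := by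
  have hk' : (1 : ℝ) ≤ k := by exact_mod_cast hk
  set c := Real.log (12 * k / β) with hc
  have hc0 : 0 ≤ c := Real.log_nonneg (by rw [le_div_iff₀ hβ0]; linarith)
  refine ⟨(k + 1) * (8 * (c + 1)) / ε + 1, le_add_of_nonneg_left (by positivity), fun N hN => ?_⟩
  have hN' : (2 : ℝ) ≤ N := by exact_mod_cast hN
  have hl : Real.log 2 ≤ Real.log N := Real.log_le_log two_pos hN'
  have hl2 := Real.log_two_gt_d9
  -- The factor `2` ensures `l ≥ 1` for all `N ≥ 2`, so powers of `l` are monotone in the exponent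
  -- and `√x ≤ x` applies to the quantity under the root.
  set l := 2 * Real.log N with hldef
  have hl1 : 1 ≤ l := by linarith
  have hL : Real.log (12 * k * N / β) = c + Real.log N := by
    rw [hc, ← Real.log_mul (by positivity) (by positivity)]
    congr 1; ring
  have hx : 1 ≤ 8 * (c + 1) * l := by nlinarith
  have h1 : 8 * Real.log (12 * k * N / β) ≤ 8 * (c + 1) * l := by
    rw [hL]; nlinarith
  have h2 : √(8 * Real.log (12 * k * N / β)) ≤ 8 * (c + 1) * l :=
    Real.sqrt_le_iff.2 ⟨by linarith, h1.trans (le_self_pow₀ hx two_ne_zero)⟩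
  calc noiseFactor k N ε β ≤ (k + 1) * (8 * (c + 1) * l) / ε := by
        unfold noiseFactor; gcongr
    _ = (k + 1) * (8 * (c + 1)) / ε * l := by ring
    _ ≤ _ := by gcongr; linarith

lemma dHat_add_le {N d : ℕ} {A l : ℝ} (hd : 1 ≤ d) (hA : 1 ≤ A) (hl : 1 ≤ l)
    (h0 : 0 ≤ noiseFactor k N ε β) (h : noiseFactor k N ε β ≤ A * l) :
    dHat k N d ε β + noiseFactor k N ε β * √(dHat k N d ε β) + noiseFactor k N ε β ≤
      9 * A ^ 3 * d * l ^ 3 := by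
  set g := noiseFactor k N ε β with hg
  set D := dHat k N d ε β with hD
  have hd' : (1 : ℝ) ≤ d := by exact_mod_cast hd
  have hAl : 1 ≤ A * l := one_le_mul_of_one_le_of_one_le hA hl
  have hD1 : (d : ℝ) ≤ D := by
    rw [hD, dHat]; exact_mod_cast le_max_left _ _
  have hg2 : g ^ 2 ≤ (A * l) ^ 2 := by gcongr
  have hAl2 : 1 ≤ (A * l) ^ 2 := one_le_pow₀ hAl
  have hD2 : D ≤ 3 * (A * l) ^ 2 * d := by
    rw [hD, dHat, Nat.cast_max]
    refine max_le ?_ ?_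
    · nlinarith
    · have := (Nat.ceil_lt_add_one (sq_nonneg g)).le
      nlinarith
  have hs : √D ≤ D := Real.sqrt_le_iff.2
    ⟨by linarith, le_self_pow₀ (hd'.trans hD1) two_ne_zero⟩
  calc D + g * √D + g ≤ D + g * D + g * D := by
        gcongr; exact le_mul_of_one_le_right h0 (hd'.trans hD1)
    _ = D * (1 + 2 * g) := by ring
    _ ≤ (3 * (A * l) ^ 2 * d) * (3 * (A * l)) := by
        gcongr; linarith
    _ = _ := by ring

theorem exists_errorBound_le (hk : 1 ≤ k) (hε : 0 < ε) (hβ0 : 0 < β) (hβ1 : β < 1) :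
    ∃ (C : ℝ) (p : ℕ), ∀ N d : ℕ, 2 ≤ N → 1 ≤ d →
      noiseFactor k N ε β ≤ C * Real.log N ^ p ∧
      errorBound k N d ε β ≤ C * (√(N : ℝ) * (d : ℝ) ^ k) * Real.log N ^ p := by
  obtain ⟨A, hA, hγ⟩ := exists_noiseFactor_le hk hε hβ0 hβ1
  set c₁ : ℝ := (k + 1) * √(2 / β) * (k + 2) ^ k with hc₁
  set c₂ : ℝ := k * (k + 1) * A * (9 * A ^ 3) ^ (k - 1) with hc₂
  have h₁ : 0 ≤ c₁ := by positivity
  have h₂ : 0 ≤ c₂ := by positivity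
  -- Each of the `k - 1` factors of the second term costs at most `l³` and the leading `γ` costs
  -- `l`, so `3 * k` suffices. The power of `2` converts `2 * log N` back to `log N`.
  refine ⟨(A + c₁ + c₂) * 2 ^ (3 * k), 3 * k, fun N d hN hd => ?_⟩
  have hN' : (2 : ℝ) ≤ N := by exact_mod_cast hN
  have hd' : (1 : ℝ) ≤ d := by exact_mod_cast hd
  have hl : Real.log 2 ≤ Real.log N := Real.log_le_log two_pos hN'
  have hl2 := Real.log_two_gt_d9
  have hγ' := hγ N hN
  have h0 := noiseFactor_nonneg k N hε β
  have e1 : (A + c₁ + c₂) * 2 ^ (3 * k) * Real.log N ^ (3 * k) =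
      (A + c₁ + c₂) * (2 * Real.log N) ^ (3 * k) := by rw [mul_pow]; ring
  have e2 : (A + c₁ + c₂) * 2 ^ (3 * k) * (√(N : ℝ) * (d : ℝ) ^ k) * Real.log N ^ (3 * k) =
      (A + c₁ + c₂) * (√(N : ℝ) * (d : ℝ) ^ k) * (2 * Real.log N) ^ (3 * k) := by
    rw [mul_pow]; ring
  rw [e1, e2]
  set l := 2 * Real.log N with hldef
  have hl1 : 1 ≤ l := by linarith
  have hlp : 1 ≤ l ^ (3 * k) := one_le_pow₀ hl1
  constructor
  · refine hγ'.trans (mul_le_mul (by linarith) (le_self_pow₀ hl1 (by omega)) (by linarith)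
      (by linarith))
  have hfirst : (k + 1) * √(2 * N / β) * ((d : ℝ) + k + 1) ^ k ≤
      c₁ * (√(N : ℝ) * (d : ℝ) ^ k) * l ^ (3 * k) := by
    have hs : √(2 * N / β) = √(2 / β) * √(N : ℝ) := by
      rw [← Real.sqrt_mul (by positivity)]; congr 1; ring
    have hb : (d : ℝ) + k + 1 ≤ (k + 2) * d := by
      have : (0 : ℝ) ≤ k := k.cast_nonneg
      nlinarith
    calc (k + 1) * √(2 * N / β) * ((d : ℝ) + k + 1) ^ k
        ≤ (k + 1) * (√(2 / β) * √(N : ℝ)) * ((k + 2) * d) ^ k := by rw [hs]; gcongr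
      _ = c₁ * (√(N : ℝ) * (d : ℝ) ^ k) := by rw [hc₁, mul_pow]; ring
      _ ≤ _ := le_mul_of_one_le_right (by positivity) hlp
  have hD : 0 ≤ dHat k N d ε β := by unfold dHat; positivity
  have hsecond : k * (k + 1) * noiseFactor k N ε β * √(N : ℝ)
      * (dHat k N d ε β + noiseFactor k N ε β * √(dHat k N d ε β) + noiseFactor k N ε β) ^ (k - 1)
      ≤ c₂ * (√(N : ℝ) * (d : ℝ) ^ k) * l ^ (3 * k) := by
    calc _ ≤ k * (k + 1) * (A * l) * √(N : ℝ) * (9 * A ^ 3 * d * l ^ 3) ^ (k - 1) := by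
          gcongr; exact dHat_add_le hd hA hl1 h0 hγ'
      _ = c₂ * (√(N : ℝ) * (d : ℝ) ^ (k - 1)) * l ^ (3 * (k - 1) + 1) := by
          rw [hc₂, pow_succ l (3 * (k - 1)), pow_mul l, mul_pow _ (l ^ 3), mul_pow _ (d : ℝ)]; ring
      _ ≤ c₂ * (√(N : ℝ) * (d : ℝ) ^ k) * l ^ (3 * k) := by
          gcongr <;> first | assumption | omega
  calc errorBound k N d ε β ≤ c₁ * (√(N : ℝ) * (d : ℝ) ^ k) * l ^ (3 * k) +
        c₂ * (√(N : ℝ) * (d : ℝ) ^ k) * l ^ (3 * k) := add_le_add hfirst hsecond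
    _ = (c₁ + c₂) * (√(N : ℝ) * (d : ℝ) ^ k) * l ^ (3 * k) := by ring
    _ ≤ _ := by gcongr; linarith

end Asymptotics

/-! ### Transfer to the law of the mechanism -/

section Transfer

variable {V : Type*} [Fintype V] {k : ℕ}

theorem output_eq_outputFun (G : SimpleGraph V) [DecidableRel G.Adj] (T : PatternTree k) (ε : ℝ) :
    (treeMechanism T ε V).output G = outputFun G T ε ∘
      fun ω : V → Fin (k + 1) × (Fin k → ℝ) => (fun i => (ω i).1, fun c i => (ω i).2 c) :=
  funext fun ω => output_eq_noisySum G ε T ω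

variable {G : SimpleGraph V} [DecidableRel G.Adj]

theorem integrable_output (T : PatternTree k) {ε : ℝ} (hε : 0 < ε) :
    Integrable ((treeMechanism T ε V).output G) (treeMechanism T ε V).law := by
  rw [output_eq_outputFun]
  exact (measurePreserving_seeds T ε).integrable_comp_of_integrable (integrable_outputFun T hε)

theorem integral_output (T : PatternTree k) {ε : ℝ} (hε : 0 < ε) :
    ∫ ω, (treeMechanism T ε V).output G ω ∂(treeMechanism T ε V).law = T.patternCount G := by
  have hmp := measurePreserving_seeds (V := V) T ε
  rw [← integral_outputFun (G := G) T hε, ← hmp.map_eq,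
    integral_map hmp.measurable.aemeasurable (measurable_outputFun T ε).aestronglyMeasurable,
    output_eq_outputFun]
  rfl

theorem le_law_real_output {ε β : ℝ} (T : PatternTree k) (hk : 1 ≤ k) (hε : 0 < ε)
    (hε2 : ε ≤ √(8 * ((k : ℝ) + 1) / 3)) (hβ0 : 0 < β) (hβ1 : β < 1)
    (hL : k = 1 → Real.log (12 * k * Fintype.card V / β) ≤ Fintype.card V) :
    1 - β ≤ (treeMechanism T ε V).law.real {ω | |(treeMechanism T ε V).output G ω -
      T.patternCount G| ≤ errorBound k (Fintype.card V) G.maxDegree ε β} := by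
  have hm : MeasurableSet {q | |outputFun G T ε q - T.patternCount G| ≤
      errorBound k (Fintype.card V) G.maxDegree ε β} :=
    measurableSet_le ((measurable_outputFun T ε).sub_const _).abs measurable_const
  have h := (measurePreserving_seeds T ε).measureReal_preimage hm.nullMeasurableSet
  have hc : {q | |outputFun G T ε q - T.patternCount G| ≤
      errorBound k (Fintype.card V) G.maxDegree ε β}ᶜ =
      {q | errorBound k (Fintype.card V) G.maxDegree ε β <
        |outputFun G T ε q - T.patternCount G|} := by
    ext q; simp
  have h2 := law_real_error_le (G := G) T hk hε hε2 hβ0 hβ1 hL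
  rw [← hc, probReal_compl_eq_one_sub hm] at h2
  rw [output_eq_outputFun]
  exact (by linarith : 1 - β ≤ _).trans h.ge

end Transfer

end
theorem mainTheorem1 (k : ℕ) (hk : 1 ≤ k) (T : PatternTree k) (ε : ℝ) (hε : 0 < ε) :
    (∀ (V : Type*) [Fintype V] (G : SimpleGraph V) [DecidableRel G.Adj],
      -- number of rounds
      (treeMechanism T ε V).rounds = k + 2 - T.leaves.card ∧
      -- unbiasedness
      Integrable ((treeMechanism T ε V).output G) (treeMechanism T ε V).law ∧
      ∫ ω, (treeMechanism T ε V).output G ω ∂(treeMechanism T ε V).law = T.patternCount G ∧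
      -- the error bound holds with probability at least `1 - β`
      (ε ≤ √(8 * ((k : ℝ) + 1) / 3) →
        ∀ β : ℝ, 0 < β → β < 1 →
          (k = 1 → Real.log (12 * k * Fintype.card V / β) ≤ Fintype.card V) →
          1 - β ≤ (treeMechanism T ε V).law.real
            {ω | |(treeMechanism T ε V).output G ω - T.patternCount G| ≤
              errorBound k (Fintype.card V) G.maxDegree ε β})) ∧
    -- for fixed `k`, `ε`, `β`: the factor `γ` is `Õ(1)` and the error bound is `Õ(√N d^k)`
    (∀ β : ℝ, 0 < β → β < 1 → ∃ (C : ℝ) (p : ℕ), ∀ N d : ℕ, 2 ≤ N → 1 ≤ d →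
      noiseFactor k N ε β ≤ C * Real.log N ^ p ∧
      errorBound k N d ε β ≤ C * (√(N : ℝ) * (d : ℝ) ^ k) * Real.log N ^ p) := by
  refine ⟨fun V _ G _ => ⟨treeMechanism_rounds ε T, integrable_output T hε, integral_output T hε,
    fun hε2 β hβ0 hβ1 hL => le_law_real_output T hk hε hε2 hβ0 hβ1 hL⟩,
    fun β hβ0 hβ1 => exists_errorBound_le hk hε hβ0 hβ1⟩
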